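/- **Setting.** Let $\phi_n$ ($n\in\mathbb Z$) be neutral fermions, $\phi_m\phi_n+\phi_n\phi_m=(-1)^m\delta_{m,-n}$, with vacua $\phi_m|0\rangle=0$ ($m<0$), $\langle 0|\phi_m=0$ ($m>0$), $\langle0|0\rangle=1$, $\langle0|\phi_0|0\rangle=0$. Let ${\bf t}=(t_1,t_3,\dots)$, ${\bf t}^*=(t^*_1,t^*_3,\dots)$, $\gamma=(\gamma_1,\gamma_3,\dots)$ be formal variables with odd numbers, and let $r:\mathbb Z\to\mathbb C$ satisfy $r(n)=r(1-n)$. Put $$H({\bf t})=\sum_{n=1,3,\dots}t_nH_n,\quad H_n=\tfrac12\sum_{k\in\mathbb Z}(-1)^{k+1}\phi_k\phi_{-k-n},$$ $$B({\bf t}^*)=\sum_{k=1,3,\dots}t^*_kB_k,\quad B_k=\tfrac12\sum_{n\in\mathbb Z}(-1)^n\phi_n\phi_{k-n}\,r(n)r(n-1)\cdots r(n-k+1),$$ $$\tau_r({\bf t},{\bf t}^*)=\langle0|e^{H({\bf t})}e^{-B({\bf t}^*)}|0\rangle ,$$ a formal power series in ${\bf t}^*$ with coefficients in $\mathbb C[t_1,t_3,\dots]$.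 For a complex sequence $T=(T_n)_{n\in\mathbb Z}$ with $T_{-n}=-T_n$ put $\tau({\bf t},T,{\bf t}^*)=\tau_r({\bf t},{\bf t}^*)$ with $r(n)=e^{T_{n-1}-T_n}$. On $\mathbb C[t_1,t_3,\dots]$ consider the vertex operator $$Z(z)=\sum_{m\in\mathbb Z}Z_mz^m=e^{\xi({\bf t},z)}e^{-2\xi(\tilde\partial,z^{-1})},\quad \xi({\bf t},z)=\sum_{n=1,3,\dots}z^nt_n,\quad \tilde\partial=\Big(\frac{\partial}{\partial t_1},\frac13\frac{\partial}{\partial t_3},\frac15\frac{\partial}{\partial t_5},\dots\Big),$$ and, with $D=z\frac{d}{dz}$ and $r(D)z^m=r(m)z^m$, the operators $$\Omega_r({\bf t}^*)=-\frac14\,\frac1{2\pi\sqrt{-1}}\oint Z(-z)\Big(\sum_{k=1,3,\dots}t^*_k\big(\tfrac1z r(D)\big)^k\Big)Z(z)\frac{dz}z ,$$ where $\frac1{2\pi\sqrt{-1}}\oint(\cdot)\frac{dz}{z}$ denotes the coefficient of $z^0$, and $$Z_{nn}=\frac{(-1)^{n+1}}4\,\big(Z_nZ_{-n}-c_n\big),\qquad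 c_n=\text{the constant term of the polynomial }Z_nZ_{-n}\cdot1 .$$ **Proposition.** (1) For every odd $k\ge1$ the coefficient of $t^*_k$ in $\Omega_r({\bf t}^*)$ is a well-defined operator on $\mathbb C[t_1,t_3,\dots]$ (on each polynomial only finitely many terms $Z_{k-m}Z_m$ of the sum over $m\in\mathbb Z$ contribute), and $$e^{\Omega_r(\gamma)}\cdot\tau_r({\bf t},{\bf t}^*)=\tau_r({\bf t},{\bf t}^*+\gamma),\qquad e^{\Omega_r({\bf t}^*)}\cdot1=\tau_r({\bf t},{\bf t}^*),$$ as formal power series in ${\bf t}^*,\gamma$, respectively in ${\bf t}^*$, with coefficients in $\mathbb C[t_1,t_3,\dots]$. (2) For all complex sequences $T=(T_n)_{n\in\mathbb Z}$, $\gamma=(\gamma_n)_{n\in\mathbb Z}$ with $T_{-n}=-T_n$, $\gamma_{-n}=-\gamma_n$, the sum $\sum_{n\in\mathbb Z}\gamma_nZ_{nn}$ has on each polynomial only finitely many nonzero terms, and $$e^{\sum_{n\in\mathbb Z}\gamma_nZ_{nn}}\cdot\tau({\bf t},T,{\bf t}^*)=\tau({\bf t},T+\gamma,{\bf t}^*),\qquad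 e^{\sum_{n\in\mathbb Z}T_nZ_{nn}}\cdot\exp\Big(\frac12\sum_{n=1,3,\dots}nt_nt^*_n\Big)=\tau({\bf t},T,{\bf t}^*),$$ where the operators act on the coefficients of the powers of ${\bf t}^*$ and the Taylor series of their exponentials converge coefficientwise. -/

import Mathlib

namespace BKP

noncomputable section

/-! Conventions: the odd integer `2 * i + 1` is encoded by the index `i : ℕ`; thus the times
`t₁, t₃, t₅, …` are indexed by `ℕ`, the variable `i` standing for `t_{2i+1}`. -/

/-! ### Pointwise finite sums of operators and exponentials in formal times -/

/-- A family of operators such that on every vector only finitely many members act nontrivially. -/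
def PointwiseFinite {M ι : Type*} [AddCommGroup M] [Module ℂ M] (A : ι → Module.End ℂ M) : Prop :=
  ∀ v : M, {i | A i v ≠ 0}.Finite

/-- The sum `∑ i, A i` of a family of linear maps which on every vector has only finitely many
nonzero members: it is computed on the vectors of a basis `b` and extended linearly. -/
def opSum {M N ι κ : Type*} [AddCommGroup M] [Module ℂ M] [AddCommGroup N] [Module ℂ N]
    (b : Module.Basis κ ℂ M) (A : ι → M →ₗ[ℂ] N) : M →ₗ[ℂ] N :=
  b.constr ℂ fun j => ∑ᶠ i, A i (b j)

/-- The operator `∑ i, s_i A_i`, with formal commuting variables `s_i`, on the formal power series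
`f` in the `s_i` with coefficients in the vector space `M`. -/
def timeAct {M σ : Type*} [AddCommGroup M] [Module ℂ M] (A : σ → Module.End ℂ M)
    (f : (σ →₀ ℕ) → M) : (σ →₀ ℕ) → M :=
  fun α => ∑ i ∈ α.support, A i (f (α - Finsupp.single i 1))

/-- `exp (∑ i, s_i A_i)` applied to the formal power series `f` in the `s_i`: the Taylor series
of the exponential. Its `j`-th term contributes to the coefficient of `s ^ α` only for
`j ≤ |α|`. -/
def timeExp {M σ : Type*} [AddCommGroup M] [Module ℂ M] (A : σ → Module.End ℂ M)
    (f : (σ →₀ ℕ) → M) : (σ →₀ ℕ) → M :=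
  fun α => ∑ j ∈ Finset.range (α.degree + 1),
    ((Nat.factorial j : ℂ)⁻¹) • ((timeAct A)^[j] f) α

/-! ### Neutral fermions and their Fock space -/

/-- The right Fock space. The basis vector indexed by the finite set `{n₁ > ⋯ > n_k ≥ 0}` is
`φ_{n₁} ⋯ φ_{n_k} |0⟩`. -/
abbrev Fock : Type := Finset ℕ →₀ ℂ

/-- The standard basis of the Fock space. -/
abbrev fockBasis : Module.Basis (Finset ℕ) ℂ Fock := Finsupp.basisSingleOne

/-- The right vacuum vector `|0⟩`. -/
def vac : Fock := Finsupp.single ∅ 1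

/-- The left vacuum `⟨0|`: the coefficient of `|0⟩`. -/
def vacL : Fock →ₗ[ℂ] ℂ := Finsupp.lapply ∅

/-- The sign `(-1) ^ #{s ∈ S : s > m}` from moving `φ_{±m}` past the `φ_s` with `s > m`. -/
def moveSign (S : Finset ℕ) (m : ℕ) : ℂ := (-1) ^ (S.filter (fun s => m < s)).card

/-- The value of `φ_n` on the basis vector indexed by `S`. For `n > 0` it creates `n`; for
`n = -m < 0` it removes `m` (as `φ_{-m} φ_m + φ_m φ_{-m} = (-1) ^ m`); and `φ_0` creates or
removes `0` (as `φ_0 ^ 2 = 1 / 2`). -/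
def phiOnBasis (n : ℤ) (S : Finset ℕ) : Fock :=
  if n.natAbs ∈ S then
    if 0 < n then 0
    else if n = 0 then Finsupp.single (S.erase 0) (moveSign S 0 * (1 / 2))
    else Finsupp.single (S.erase n.natAbs) (moveSign S n.natAbs * (-1) ^ n.natAbs)
  else
    if 0 ≤ n then Finsupp.single (insert n.natAbs S) (moveSign S n.natAbs)
    else 0

/-- The neutral fermion modes `φ_n`, `n ∈ ℤ`, with `φ_m φ_n + φ_n φ_m = (-1) ^ m δ_{m,-n}`,
`φ_m |0⟩ = 0` for `m < 0` and `⟨0| φ_m = 0` for `m > 0`. -/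
def phi (n : ℤ) : Module.End ℂ Fock := fockBasis.constr ℂ (phiOnBasis n)

/-- The Hamiltonians `H_n = (1/2) ∑_{k ∈ ℤ} (-1)^{k+1} φ_k φ_{-k-n}` (`n` odd). -/
def ham (n : ℤ) : Module.End ℂ Fock :=
  opSum fockBasis fun k : ℤ => ((1 / 2 : ℂ) * (-1) ^ (k + 1)) • (phi k * phi (-k - n))

/-- The product `r(n) r(n-1) ⋯ r(n-k+1)`. -/
def rProd (r : ℤ → ℂ) (n : ℤ) (k : ℕ) : ℂ := ∏ j ∈ Finset.range k, r (n - j)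

/-- The operators `B_k = (1/2) ∑_{n ∈ ℤ} (-1)^n r(n) r(n-1) ⋯ r(n-k+1) φ_n φ_{k-n}` (`k` odd). -/
def opB (r : ℤ → ℂ) (k : ℕ) : Module.End ℂ Fock :=
  opSum fockBasis fun n : ℤ =>
    ((1 / 2 : ℂ) * (-1) ^ n * rProd r n k) • (phi n * phi ((k : ℤ) - n))

/-! ### The tau-function -/

/-- The polynomials in the times `t₁, t₃, t₅, …`. -/
abbrev Pol : Type := MvPolynomial ℕ ℂ

/-- The monomial basis of the polynomials in `t`. -/
abbrev polBasis : Module.Basis (ℕ →₀ ℕ) ℂ Pol := MvPolynomial.basisMonomials ℕ ℂ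

/-- The right action `ω ↦ ω H(t)`, `H(t) = ∑_{n = 1,3,…} t_n H_n`, on covectors of the Fock
space with values in the polynomials in `t`. -/
def actH (ω : Fock →ₗ[ℂ] Pol) : Fock →ₗ[ℂ] Pol :=
  opSum fockBasis fun i : ℕ =>
    (LinearMap.mulLeft ℂ (MvPolynomial.X i : Pol)) ∘ₗ ω ∘ₗ ham (2 * i + 1)

/-- The covector `⟨0| e^{H(t)}`; every vector is killed by almost all of the terms
`⟨0| H(t)^j / j!`. -/
def vacExpH : Fock →ₗ[ℂ] Pol :=
  opSum fockBasis fun j : ℕ =>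
    ((Nat.factorial j : ℂ)⁻¹) • (actH^[j] (Algebra.linearMap ℂ Pol ∘ₗ vacL))

/-- `e^{-B(t*)} |0⟩`, `B(t*) = ∑_{n = 1,3,…} t*_n B_n`, as a formal power series in
`t*` with coefficients in the Fock space. -/
def expBVac (r : ℤ → ℂ) : (ℕ →₀ ℕ) → Fock :=
  timeExp (fun i : ℕ => -opB r (2 * i + 1)) (Pi.single 0 vac)

/-- The tau-function `τ_r(t, t*) = ⟨0| e^{H(t)} e^{-B(t*)} |0⟩`, a formal power series in the
variables `t*` whose coefficients are polynomials in `t`. -/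
def tau (r : ℤ → ℂ) : MvPowerSeries ℕ Pol := fun α => vacExpH (expBVac r α)

/-- The function `r(n) = e^{T_{n-1} - T_n}`. -/
def rOfT (T : ℤ → ℂ) : ℤ → ℂ := fun n => Complex.exp (T (n - 1) - T n)

/-- The tau-function `τ(t, T, t*) = τ_r(t, t*)` with `r(n) = e^{T_{n-1} - T_n}`. -/
def tauT (T : ℤ → ℂ) : MvPowerSeries ℕ Pol := tau (rOfT T)

/-! ### Vertex operators -/

/-- `ξ(s, z) = ∑_{n = 1,3,…} z^n s_n`, where `s i` is the time with number `2 * i + 1`; the times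
may be operators. -/
def xi {A : Type*} [Ring A] [Algebra ℂ A] (s : ℕ → A) : PowerSeries A :=
  PowerSeries.mk fun n => if Odd n then s (n / 2) else 0

/-- The coefficient of `z ^ a` in `e^{ξ(s, z)}` (there `ξ(s, z) ^ j` contributes only for
`j ≤ a`). -/
def expXiCoeff {A : Type*} [Ring A] [Algebra ℂ A] (s : ℕ → A) (a : ℕ) : A :=
  ∑ j ∈ Finset.range (a + 1), ((Nat.factorial j : ℂ)⁻¹) • PowerSeries.coeff a (xi s ^ j)

/-- The coefficient `Z_m` of `z ^ m` in the vertex operator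
`Z(z) = e^{ξ(t, z)} e^{-2 ξ(∂̃, z⁻¹)}`, `∂̃ = (∂_{t₁}, ∂_{t₃} / 3, ∂_{t₅} / 5, …)`: the sum over
`b` of the coefficient of `z ^ (m + b)` in the first factor times that of `z ^ (-b)` in the
second one. -/
def vertex (m : ℤ) : Module.End ℂ Pol :=
  opSum polBasis fun b : ℕ =>
    if 0 ≤ m + b then
      LinearMap.mulLeft ℂ (expXiCoeff (fun i => (MvPolynomial.X i : Pol)) (m + b).toNat) *
        expXiCoeff
          (fun i => (-2 / (2 * i + 1) : ℂ) •
            ((MvPolynomial.pderiv i : Derivation ℂ Pol Pol) : Module.End ℂ Pol)) b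
    else 0

/-- The summands of `Ω_{r,k}`: since `(z⁻¹ r(D))^k z^m = r(m) ⋯ r(m-k+1) z^{m-k}`, the constant
term in `z` of `-(1/4) Z(-z) (z⁻¹ r(D))^k Z(z)` is the sum over `m` of these operators. -/
def omegaTerm (r : ℤ → ℂ) (k : ℕ) (m : ℤ) : Module.End ℂ Pol :=
  (-(1 / 4 : ℂ) * (-1) ^ ((k : ℤ) - m) * rProd r m k) • (vertex ((k : ℤ) - m) * vertex m)

/-- The coefficient `Ω_{r,k}` (`k` odd) of the time `t*_k` in
`Ω_r(t*) = -(1/4) (2πi)⁻¹ ∮ Z(-z) ξ_r(t*, z⁻¹) Z(z) dz / z`,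
`ξ_r(t*, z⁻¹) = ∑_{k = 1,3,…} t*_k (z⁻¹ r(D))^k`, `D = z d/dz`. -/
def omega (r : ℤ → ℂ) (k : ℕ) : Module.End ℂ Pol := opSum polBasis (omegaTerm r k)

/-- The operator `Z_{nn} = ((-1)^{n+1} / 4) :Z_n Z_{-n}:`, where `Z_n Z_{-n}` is the constant
term in `z`, `w` of `(z / w)^n Z(w) Z(z)`, and `:A:` is `A` minus the constant term of the
polynomial `A 1`. -/
def vertexNN (n : ℤ) : Module.End ℂ Pol :=
  ((-1 : ℂ) ^ (n + 1) / 4) •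
    (vertex n * vertex (-n)
      - MvPolynomial.constantCoeff (vertex n (vertex (-n) 1)) • (1 : Module.End ℂ Pol))

/-- The operator `∑_{n ∈ ℤ} γ_n Z_{nn}`. -/
def sumNN (γ : ℤ → ℂ) : Module.End ℂ Pol := opSum polBasis fun n : ℤ => γ n • vertexNN n

/-- `g = e^A f`, where `A` acts coefficientwise on power series in `t*` with polynomial
coefficients: the Taylor series of the exponential applied to `f` converges to `g`, for each
coefficient. -/
def IsExpApply (A : Module.End ℂ Pol) (f g : MvPowerSeries ℕ Pol) : Prop :=
  ∀ α d : ℕ →₀ ℕ,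
    HasSum
      (fun k : ℕ => MvPolynomial.coeff d (((Nat.factorial k : ℂ)⁻¹) •
        (A ^ k) (MvPowerSeries.coeff α f)))
      (MvPolynomial.coeff d (MvPowerSeries.coeff α g))

/-- `exp ((1/2) ∑_{n = 1,3,…} n t_n t*_n)`. -/
def tauVac : MvPowerSeries ℕ Pol :=
  timeExp
    (fun i : ℕ => LinearMap.mulLeft ℂ (((2 * i + 1 : ℂ) / 2) • (MvPolynomial.X i : Pol)))
    (1 : MvPowerSeries ℕ Pol)

/-- `f(t, t*)` as a series in the two sets of variables `t*` (left summand) and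
`γ` (right summand). -/
def inTimes (f : MvPowerSeries ℕ Pol) : MvPowerSeries (ℕ ⊕ ℕ) Pol :=
  MvPowerSeries.subst (fun i : ℕ => (MvPowerSeries.X (Sum.inl i) : MvPowerSeries (ℕ ⊕ ℕ) Pol)) f

/-- `f(t, t* + γ)` as a series in the two sets of variables `t*` (left summand) and
`γ` (right summand). -/
def shiftTimes (f : MvPowerSeries ℕ Pol) : MvPowerSeries (ℕ ⊕ ℕ) Pol :=
  MvPowerSeries.subst
    (fun i : ℕ => (MvPowerSeries.X (Sum.inl i) + MvPowerSeries.X (Sum.inr i) :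
      MvPowerSeries (ℕ ⊕ ℕ) Pol)) f

/-- `e^{Ω_r(γ)} F`, `Ω_r(γ) = ∑_{k = 1,3,…} γ_k Ω_{r,k}`, for a power series `F` in the variables
`t*` (left summand) and `γ` (right summand) with coefficients in the polynomials in `t`. -/
def expOmegaGamma (r : ℤ → ℂ) (F : MvPowerSeries (ℕ ⊕ ℕ) Pol) : MvPowerSeries (ℕ ⊕ ℕ) Pol :=
  timeExp (Sum.elim (fun _ => 0) (fun i : ℕ => omega r (2 * i + 1))) F

/-- `e^{Ω_r(t*)} F` for a power series `F` in `t*` with coefficients in the polynomials in `t`. -/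
def expOmega (r : ℤ → ℂ) (F : MvPowerSeries ℕ Pol) : MvPowerSeries ℕ Pol :=
  timeExp (fun i : ℕ => omega r (2 * i + 1)) F

end

end BKP

/-!
The two shift formulas hold because, under the boson–fermion correspondence
`v ↦ ⟨0| e^{H(t)} v` (`vacExpH`), the operators `Ω_{r,k}` and `Z_{nn}` on polynomials are the images
of operators on the Fock space for which the formulas are evident.

*The correspondence.* The linear map `vacExpH` is surjective, because it turns `H_{-n}` into
multiplication by `n t_n / 2` (`vacExpH_ham_neg`), and it turns `φ_a φ_b` into `Z_a Z_b / 2`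
(`vacExpH_phi_phi`). For the second fact choose `c` with `c² = 1 / 2` and replace `⟨0|` by the
covector `w = ⟨0| (1 + 2 c φ_0)`, which satisfies `w φ_0 = c w` and agrees with `⟨0|` on the even
part of the Fock space. Then even a single fermion corresponds to a vertex operator,
`w e^{H(t)} φ_a v = c Z_a (w e^{H(t)} v)` (`expH_vacC_phi`): both sides satisfy the same
differential equations in `t`, as `[H_n, φ_a] = φ_{a-n}` and `[∂ / ∂t_n, Z_a] = Z_{a-n}`, and their
constant terms agree because `w φ_{-b}` is the coefficient of `x^b` in
`c w e^{-2 ∑ H_n x^n / n}` (`vacC_phi_neg`). That identity is proved on the generators of the Fock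
space by commuting `e^{-2 ∑ H_n x^n / n}` past a fermion. Only surjectivity of the correspondence is
needed, and the finiteness of all sums of operators on polynomials is inherited from the energy
filtration of the Fock space.

*First formula.* The bilinear formula turns `-B_k` into `Ω_{r,k}` (`vacExpH_neg_opB`), hence
`e^{-B(t*)} |0⟩` into `e^{Ω_r(t*)} 1`. The symmetry `r(n) = r(1 - n)` makes the `B_k` commute
(`opB_comm`), since their actions on the fermions commute and an even operator commuting with all
fermions is a scalar. So `τ_r` solves `∂τ / ∂t*_k = Ω_{r,k} τ` with commuting `Ω_{r,k}`, and both
sides of the shift formula solve the same linear system with the same initial value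
(`timeExp_inTimes`).

*Second formula.* The operator `∑ γ_n Z_{nn}` is the image of the diagonal operator with eigenvalue
`-∑_{n ∈ S} γ_n` on the basis vector indexed by `S` (`sumNN_vacExpH`), so its exponential converges
coefficientwise. The exponential of that diagonal operator rescales `φ_n` by `e^{-γ_n}` and
therefore conjugates `B_k` for the sequence `T` into `B_k` for `T + γ` (`diagOp_exp_opB`), because
`r(n) ⋯ r(n-k+1) = e^{T_{n-k} - T_n}`. For `T = 0` the flows `-B_k` are the Hamiltonians `H_{-k}`,
which gives the exponential function of the special case (`tauT_zero`).
-/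

namespace BKP

noncomputable section

/-! ### Pointwise finite sums of operators -/

section OpSum

variable {M N ι κ : Type*} [AddCommGroup M] [Module ℂ M] [AddCommGroup N] [Module ℂ N]

theorem opSum_apply (b : Module.Basis κ ℂ M) {A : ι → M →ₗ[ℂ] N}
    (h : ∀ v, {i | A i v ≠ 0}.Finite) (v : M) : opSum b A v = ∑ᶠ i, A i v := by
  let L : M →ₗ[ℂ] N :=
    { toFun := fun v => ∑ᶠ i, A i v
      map_add' := fun x y => by simp only [map_add]; exact finsum_add_distrib (h x) (h y)
      map_smul' := fun a x => by
        simp only [map_smul, RingHom.id_apply]; exact (smul_finsum' a (h x)).symm }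
  have : opSum b A = L := b.ext fun j => by simp [opSum, L]
  rw [this]; rfl

end OpSum

/-! ### Exponentials in formal times -/

section Time

variable {M N σ : Type*} [AddCommGroup M] [Module ℂ M] [AddCommGroup N] [Module ℂ N]

/-- The partial derivative `∂f / ∂s_i` of a formal power series `f` in the variables `s`, given by
its coefficients. -/
def coeffD (i : σ) (f : (σ →₀ ℕ) → M) : (σ →₀ ℕ) → M :=
  fun α => ((α i : ℂ) + 1) • f (α + Finsupp.single i 1)

theorem timeAct_map {L : M →ₗ[ℂ] N} {A : σ → Module.End ℂ M} {B : σ → Module.End ℂ N}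
    (h : ∀ i v, L (A i v) = B i (L v)) (f : (σ →₀ ℕ) → M) :
    (fun α => L (timeAct A f α)) = timeAct B fun α => L (f α) := by
  funext α
  simp [timeAct, h]

/-- Exponentials of intertwined operators are intertwined. -/
theorem timeExp_map {L : M →ₗ[ℂ] N} {A : σ → Module.End ℂ M} {B : σ → Module.End ℂ N}
    (h : ∀ i v, L (A i v) = B i (L v)) (f : (σ →₀ ℕ) → M) (α : σ →₀ ℕ) :
    L (timeExp A f α) = timeExp B (fun α => L (f α)) α := by
  have key : ∀ j, (fun α => L ((timeAct A)^[j] f α)) = (timeAct B)^[j] fun α => L (f α) := by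
    intro j
    induction j with
    | zero => rfl
    | succ j ih => rw [Function.iterate_succ_apply', Function.iterate_succ_apply', ← ih,
        timeAct_map h]
  simp only [timeExp, map_sum, map_smul]
  refine Finset.sum_congr rfl fun j _ => ?_
  rw [← key j]

theorem timeAct_iterate_eq_zero (A : σ → Module.End ℂ M) (f : (σ →₀ ℕ) → M) (j : ℕ) :
    ∀ α : σ →₀ ℕ, α.degree < j → (timeAct A)^[j] f α = 0 := by
  induction j with
  | zero => intro α h; omega
  | succ j ih =>
    intro α h
    rw [Function.iterate_succ_apply']
    refine Finset.sum_eq_zero fun i hi => ?_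
    rw [ih, map_zero]
    have hi' : 1 ≤ α i := Nat.one_le_iff_ne_zero.2 (Finsupp.mem_support_iff.1 hi)
    have h1 : α = (α - Finsupp.single i 1) + Finsupp.single i 1 := by
      rw [tsub_add_cancel_of_le]; simpa using hi'
    have h2 : α.degree = (α - Finsupp.single i 1).degree + 1 := by
      conv_lhs => rw [h1]
      simp [map_add]
    omega

theorem coeffD_timeAct (A : σ → Module.End ℂ M) (i : σ) (f : (σ →₀ ℕ) → M) :
    coeffD i (timeAct A f) = timeAct A (coeffD i f) + fun α => A i (f α) := by
  classical
  funext α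
  have hsub : ∀ (g : (σ →₀ ℕ) → M) (β : σ →₀ ℕ) (s : Finset σ), β.support ⊆ s →
      timeAct A g β = ∑ k ∈ s, if β k = 0 then 0 else A k (g (β - Finsupp.single k 1)) := by
    intro g β s hs
    rw [timeAct, ← Finset.sum_subset hs]
    · refine Finset.sum_congr rfl fun k hk => ?_
      rw [if_neg (Finsupp.mem_support_iff.1 hk)]
    · intro k _ hk
      rw [if_pos (Finsupp.notMem_support_iff.1 hk)]
  have hs1 : (α + Finsupp.single i 1).support ⊆ insert i α.support := by
    intro k hk
    by_cases hki : k = i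
    · simp [hki]
    · simp [hki] at hk ⊢
      exact hk
  rw [coeffD, hsub _ _ _ hs1, Pi.add_apply, hsub _ α _ (Finset.subset_insert i _),
    Finset.smul_sum]
  rw [← Finset.add_sum_erase _ _ (Finset.mem_insert_self i _),
    ← Finset.add_sum_erase _ _ (Finset.mem_insert_self i α.support), add_right_comm]
  congr 1
  · rw [if_neg (by simp), add_tsub_cancel_right]
    by_cases h : α i = 0
    · simp [h]
    · rw [if_neg h, coeffD]
      have h1 : α - Finsupp.single i 1 + Finsupp.single i 1 = α := by
        rw [tsub_add_cancel_of_le]; simpa using Nat.one_le_iff_ne_zero.2 h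
      have h2 : (((α - Finsupp.single i 1 : σ →₀ ℕ) i : ℕ) : ℂ) + 1 = α i := by
        conv_rhs => rw [← h1]
        simp
      rw [h1, h2, map_smul, add_smul, one_smul]
  · refine Finset.sum_congr rfl fun k hk => ?_
    have hki : k ≠ i := Finset.ne_of_mem_erase hk
    have h0 : (α + Finsupp.single i 1 : σ →₀ ℕ) k = α k := by simp [hki]
    rw [h0]
    by_cases h : α k = 0
    · simp [h]
    · rw [if_neg h, if_neg h, coeffD, map_smul]
      have h1 : (α - Finsupp.single k 1 : σ →₀ ℕ) i = α i := by simp [hki]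
      rw [h1]
      congr 3
      ext l
      by_cases hl : l = k
      · subst hl; simp [hki.symm]
      · simp [Finsupp.single_apply, Ne.symm hl]

/-- For commuting operators `A_i`, the derivative along `s_i` of `e^{∑ s_i A_i} f` is
`A_i e^{∑ s_i A_i} f + e^{∑ s_i A_i} ∂f / ∂s_i`. -/
theorem coeffD_timeExp {A : σ → Module.End ℂ M} (hA : ∀ i k, Commute (A i) (A k)) (i : σ)
    (f : (σ →₀ ℕ) → M) (α : σ →₀ ℕ) :
    coeffD i (timeExp A f) α = A i (timeExp A f α) + timeExp A (coeffD i f) α := by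
  have hadd : ∀ (j : ℕ) (g h : (σ →₀ ℕ) → M),
      (timeAct A)^[j] (g + h) = (timeAct A)^[j] g + (timeAct A)^[j] h := by
    intro j
    induction j with
    | zero => intros; rfl
    | succ j ih =>
      intro g h
      rw [Function.iterate_succ_apply, Function.iterate_succ_apply, Function.iterate_succ_apply,
        ← ih]
      congr 1
      funext β
      simp [timeAct, Finset.sum_add_distrib]
  have hsmul : ∀ (j : ℕ) (g : (σ →₀ ℕ) → M),
      (timeAct A)^[j] (fun β => A i (g β)) = fun β => A i ((timeAct A)^[j] g β) := by
    intro j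
    induction j with
    | zero => intros; rfl
    | succ j ih =>
      intro g
      rw [Function.iterate_succ_apply, Function.iterate_succ_apply, ← ih]
      congr 1
      exact (timeAct_map (fun k v => congrArg (fun X : Module.End ℂ M => X v) (hA i k).eq)
        g).symm
  have key : ∀ j : ℕ, coeffD i ((timeAct A)^[j] f) =
      (timeAct A)^[j] (coeffD i f) + fun β => (j : ℂ) • A i ((timeAct A)^[j - 1] f β) := by
    intro j
    induction j with
    | zero => funext β; simp
    | succ j ih =>
      rw [Function.iterate_succ_apply', coeffD_timeAct, ih, Function.iterate_succ_apply']
      funext β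
      have h1 : timeAct A ((timeAct A)^[j] (coeffD i f) +
          fun β => (j : ℂ) • A i ((timeAct A)^[j - 1] f β)) β =
          timeAct A ((timeAct A)^[j] (coeffD i f)) β + (j : ℂ) • A i ((timeAct A)^[j] f β) := by
        rcases j with _ | j
        · simp [timeAct]
        · have := congrFun (hsmul 1 ((timeAct A)^[j] f)) β
          simp only [Function.iterate_one] at this
          rw [Function.iterate_succ_apply' _ j f, ← this]
          simp [timeAct, Finset.sum_add_distrib, Finset.smul_sum]
      simp only [Pi.add_apply] at h1 ⊢
      rw [h1, add_assoc]
      congr 1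
      push_cast
      simp [add_smul]
  have hdeg : (α + Finsupp.single i 1).degree = α.degree + 1 := by simp
  simp only [coeffD, timeExp, hdeg, Finset.smul_sum]
  have h2 : ∀ j, ((α i : ℂ) + 1) • ((Nat.factorial j : ℂ)⁻¹) •
        (timeAct A)^[j] f (α + Finsupp.single i 1) =
      ((Nat.factorial j : ℂ)⁻¹) • (timeAct A)^[j] (coeffD i f) α +
      ((Nat.factorial j : ℂ)⁻¹ * j) • A i ((timeAct A)^[j - 1] f α) := by
    intro j
    have := congrFun (key j) α
    rw [coeffD] at this
    rw [smul_comm, this, Pi.add_apply, smul_add, smul_smul]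
  rw [Finset.sum_congr rfl fun j _ => h2 j, Finset.sum_add_distrib, add_comm]
  congr 1
  · rw [Finset.sum_range_succ', map_sum]
    simp only [Nat.cast_zero, mul_zero, zero_smul, add_zero, map_smul, Nat.add_sub_cancel]
    refine Finset.sum_congr rfl fun j _ => ?_
    congr 1
    rw [Nat.factorial_succ]
    push_cast
    have h3 : (Nat.factorial j : ℂ) ≠ 0 := by exact_mod_cast Nat.factorial_ne_zero j
    have h4 : (j : ℂ) + 1 ≠ 0 := by exact_mod_cast Nat.succ_ne_zero j
    field_simp
  · rw [Finset.sum_range_succ, timeAct_iterate_eq_zero A _ _ α (by omega)]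
    simp

/-- A series is determined by its constant term and the evolution equations
`∂g / ∂s_i = A_i g`. -/
theorem eq_of_coeffD_eq {A : σ → Module.End ℂ M} {g h : (σ →₀ ℕ) → M}
    (hg : ∀ i α, coeffD i g α = A i (g α)) (hh : ∀ i α, coeffD i h α = A i (h α))
    (h0 : g 0 = h 0) : g = h := by
  have key : ∀ (n : ℕ) (α : σ →₀ ℕ), α.degree = n → g α = h α := by
    intro n
    induction n with
    | zero => intro α hα; rw [(Finsupp.degree_eq_zero_iff α).1 hα, h0]
    | succ n ih =>
      intro α hα
      obtain ⟨i, hi⟩ : ∃ i, α i ≠ 0 := by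
        by_contra! hcon
        have : α = 0 := Finsupp.ext hcon
        simp [this] at hα
      have h1 : α - Finsupp.single i 1 + Finsupp.single i 1 = α := by
        rw [tsub_add_cancel_of_le]; simpa using Nat.one_le_iff_ne_zero.2 hi
      have h2 : (α - Finsupp.single i 1).degree = n := by
        have : (α - Finsupp.single i 1 + Finsupp.single i 1).degree = n + 1 := by rw [h1, hα]
        simpa using this
      have e1 := hg i (α - Finsupp.single i 1)
      rw [ih _ h2, ← hh i, coeffD, coeffD, h1] at e1
      refine smul_right_injective M (r := (((α - Finsupp.single i 1 : σ →₀ ℕ) i : ℕ) : ℂ) + 1) ?_ e1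
      exact Nat.cast_add_one_ne_zero _
  funext α
  exact key _ α rfl

theorem timeExp_zero (A : σ → Module.End ℂ M) (f : (σ →₀ ℕ) → M) : timeExp A f 0 = f 0 := by
  simp [timeExp]

/-- `e^{∑ s_i A_i} v` solves the evolution equations `∂g / ∂s_i = A_i g`. -/
theorem coeffD_timeExp_const [DecidableEq (σ →₀ ℕ)] {A : σ → Module.End ℂ M}
    (hA : ∀ i k, Commute (A i) (A k)) (i : σ)
    (v : M) (α : σ →₀ ℕ) :
    coeffD i (timeExp A (Pi.single 0 v)) α = A i (timeExp A (Pi.single 0 v) α) := by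
  rw [coeffD_timeExp hA]
  have : coeffD i (Pi.single (0 : σ →₀ ℕ) v) = 0 := by
    funext β
    have : β + Finsupp.single i 1 ≠ 0 := fun h => by
      simpa using congrArg (fun γ : σ →₀ ℕ => γ i) h
    simp [coeffD]
  rw [this]
  have h0 := timeExp_map (L := (0 : M →ₗ[ℂ] M)) (A := A) (B := A) (by simp) 0 α
  simp only [LinearMap.zero_apply] at h0
  have h1 : (fun _ => 0 : (σ →₀ ℕ) → M) = 0 := rfl
  rw [h1] at h0
  rw [← h0, add_zero]

end Time

/-! ### Substitution of times -/

section Subst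

open Finsupp (single)

/-- The product `α! = ∏ s, (α s)!`. -/
def multiFact {σ : Type*} (α : σ →₀ ℕ) : ℕ := α.prod fun _ k => k.factorial

theorem multiFact_ne_zero {σ : Type*} (α : σ →₀ ℕ) : multiFact α ≠ 0 :=
  Finset.prod_ne_zero_iff.2 fun _ _ => Nat.factorial_ne_zero _

theorem multiFact_add_single {σ : Type*} (α : σ →₀ ℕ) (i : σ) :
    multiFact (α + single i 1) = (α i + 1) * multiFact α := by
  classical
  have hs1 : (α + single i 1).support ⊆ insert i α.support := by
    intro k hk
    by_cases hki : k = i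
    · simp [hki]
    · simp [hki] at hk ⊢
      exact hk
  rw [multiFact, multiFact, Finsupp.prod_of_support_subset _ hs1 _ (by simp),
    Finsupp.prod_of_support_subset α (Finset.subset_insert i _) _ (by simp),
    ← Finset.mul_prod_erase _ _ (Finset.mem_insert_self i _),
    ← Finset.mul_prod_erase _ _ (Finset.mem_insert_self i α.support), ← mul_assoc]
  congr 1
  · simp [Nat.factorial_succ]
  · refine Finset.prod_congr rfl fun k hk => ?_
    simp [Finset.ne_of_mem_erase hk]

/-- The exponents of the first set of variables. -/
def leftPart (e : ℕ ⊕ ℕ →₀ ℕ) : ℕ →₀ ℕ := e.comapDomain Sum.inl Sum.inl_injective.injOn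

/-- The exponents of the second set of variables. -/
def rightPart (e : ℕ ⊕ ℕ →₀ ℕ) : ℕ →₀ ℕ := e.comapDomain Sum.inr Sum.inr_injective.injOn

@[simp] theorem leftPart_apply (e : ℕ ⊕ ℕ →₀ ℕ) (i : ℕ) : leftPart e i = e (Sum.inl i) := rfl

@[simp] theorem rightPart_apply (e : ℕ ⊕ ℕ →₀ ℕ) (i : ℕ) : rightPart e i = e (Sum.inr i) := rfl

@[simp] theorem leftPart_add (e f : ℕ ⊕ ℕ →₀ ℕ) : leftPart (e + f) = leftPart e + leftPart f := by
  ext; simp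

@[simp] theorem rightPart_add (e f : ℕ ⊕ ℕ →₀ ℕ) :
    rightPart (e + f) = rightPart e + rightPart f := by
  ext; simp

@[simp] theorem leftPart_inl (i : ℕ) : leftPart (single (Sum.inl i) 1) = single i 1 := by
  classical
  ext j; simp [Finsupp.single_apply]

@[simp] theorem leftPart_inr (i : ℕ) : leftPart (single (Sum.inr i) 1) = 0 := by
  ext j; simp

@[simp] theorem rightPart_inl (i : ℕ) : rightPart (single (Sum.inl i) 1) = 0 := by
  ext j; simp

@[simp] theorem rightPart_inr (i : ℕ) : rightPart (single (Sum.inr i) 1) = single i 1 := by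
  classical
  ext j; simp [Finsupp.single_apply]

variable {R : Type*} [CommRing R]

theorem coeff_mul_X_eq {σ : Type*} (f : MvPowerSeries σ R) (s : σ) (e : σ →₀ ℕ) :
    MvPowerSeries.coeff e (f * MvPowerSeries.X s) =
      if e s = 0 then 0 else MvPowerSeries.coeff (e - single s 1) f := by
  classical
  rw [MvPowerSeries.X, MvPowerSeries.coeff_mul_monomial, mul_one]
  have : (single s 1 ≤ e) ↔ ¬ e s = 0 := by
    simp [Nat.one_le_iff_ne_zero]
  simp only [this, ite_not]

theorem hasSubst_inl :
    MvPowerSeries.HasSubst fun i : ℕ =>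
      (MvPowerSeries.X (Sum.inl i) : MvPowerSeries (ℕ ⊕ ℕ) R) where
  const_coeff s := by simp
  coeff_zero d := by
    classical
    refine Set.Finite.subset (leftPart d).support.finite_toSet fun i hi => ?_
    simp only [Set.mem_ofPred_eq, MvPowerSeries.coeff_X] at hi
    have : d = single (Sum.inl i) 1 := by by_contra h; simp [h] at hi
    simp [this]

theorem hasSubst_add :
    MvPowerSeries.HasSubst fun i : ℕ => (MvPowerSeries.X (Sum.inl i) + MvPowerSeries.X (Sum.inr i) :
      MvPowerSeries (ℕ ⊕ ℕ) R) where
  const_coeff s := by simp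
  coeff_zero d := by
    classical
    refine Set.Finite.subset
      ((leftPart d).support ∪ (rightPart d).support).finite_toSet fun i hi => ?_
    simp only [Set.mem_ofPred_eq, map_add, MvPowerSeries.coeff_X] at hi
    have : d = single (Sum.inl i) 1 ∨ d = single (Sum.inr i) 1 := by
      by_contra! h; simp [h] at hi
    rcases this with h | h <;> simp [h]

theorem coeff_subst_inl (f : MvPowerSeries ℕ R) (e : ℕ ⊕ ℕ →₀ ℕ) :
    MvPowerSeries.coeff e (MvPowerSeries.subst
      (fun i : ℕ => (MvPowerSeries.X (Sum.inl i) : MvPowerSeries (ℕ ⊕ ℕ) R)) f) =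
      if rightPart e = 0 then MvPowerSeries.coeff (leftPart e) f else 0 := by
  classical
  have key : ∀ (d : ℕ →₀ ℕ) (e : ℕ ⊕ ℕ →₀ ℕ), MvPowerSeries.coeff e
      (d.prod fun s k => (MvPowerSeries.X (Sum.inl s) : MvPowerSeries (ℕ ⊕ ℕ) R) ^ k) =
      if leftPart e = d ∧ rightPart e = 0 then 1 else 0 := by
    intro d e
    have : (d.prod fun s k => (MvPowerSeries.X (Sum.inl s) : MvPowerSeries (ℕ ⊕ ℕ) R) ^ k) =
        MvPowerSeries.monomial (d.mapDomain Sum.inl) 1 := by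
      induction d using Finsupp.induction_linear with
      | zero => simp [MvPowerSeries.monomial_zero_one]
      | add f g hf hg =>
        rw [Finsupp.prod_add_index' (by simp) (by intros; rw [pow_add]), hf, hg,
          MvPowerSeries.monomial_mul_monomial, Finsupp.mapDomain_add, one_mul]
      | single a n =>
        rw [Finsupp.prod_single_index (by simp), MvPowerSeries.X_pow_eq, Finsupp.mapDomain_single]
    rw [this, MvPowerSeries.coeff_monomial]
    congr 1
    refine propext ⟨?_, ?_⟩
    · rintro rfl
      constructor
      · ext i; simp [Finsupp.mapDomain_apply Sum.inl_injective]
      · ext i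
        rw [rightPart_apply, Finsupp.mapDomain_of_notMem_range]
        · rfl
        · simp
    · rintro ⟨rfl, h⟩
      ext (i | i)
      · simp [Finsupp.mapDomain_apply Sum.inl_injective]
      · rw [Finsupp.mapDomain_of_notMem_range _ _ (by simp)]
        simpa using congrArg (fun x => x i) h
  rw [MvPowerSeries.coeff_subst hasSubst_inl]
  simp only [key, smul_eq_mul, mul_ite, mul_one, mul_zero]
  rw [finsum_eq_single _ (leftPart e)]
  · simp
  · intro d hd
    rw [if_neg]
    exact fun h => hd h.1.symm

/-- The coefficients of `f(s + s')`: in terms of the divided coefficients `α! f_α` the substitution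
is addition of exponents. -/
theorem coeff_subst_add (f : MvPowerSeries ℕ R) (e : ℕ ⊕ ℕ →₀ ℕ) :
    (multiFact e : R) * MvPowerSeries.coeff e (MvPowerSeries.subst
      (fun i : ℕ => (MvPowerSeries.X (Sum.inl i) + MvPowerSeries.X (Sum.inr i) :
        MvPowerSeries (ℕ ⊕ ℕ) R)) f) =
      multiFact (leftPart e + rightPart e) *
        MvPowerSeries.coeff (leftPart e + rightPart e) f := by
  classical
  have key : ∀ (n : ℕ) (d : ℕ →₀ ℕ), d.degree = n → ∀ e : ℕ ⊕ ℕ →₀ ℕ,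
      (multiFact e : R) * MvPowerSeries.coeff e
      (d.prod fun s k => (MvPowerSeries.X (Sum.inl s) + MvPowerSeries.X (Sum.inr s) :
        MvPowerSeries (ℕ ⊕ ℕ) R) ^ k) =
      if leftPart e + rightPart e = d then (multiFact d : R) else 0 := by
    intro n
    induction n with
    | zero =>
      intro d hd e
      rw [(Finsupp.degree_eq_zero_iff d).1 hd, Finsupp.prod_zero_index, MvPowerSeries.coeff_one]
      by_cases he : e = 0
      · subst he
        have : leftPart 0 + rightPart 0 = 0 := by ext; simp
        simp [this, multiFact]
      · rw [if_neg he, if_neg, mul_zero]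
        intro h
        apply he
        ext (i | i)
        · have := congrArg (fun x => x i) h
          simp at this; simp [this]
        · have := congrArg (fun x => x i) h
          simp at this; simp [this]
    | succ n ih =>
      intro d hd e
      obtain ⟨i, hi⟩ : ∃ i, d i ≠ 0 := by
        by_contra! hcon
        have : d = 0 := Finsupp.ext hcon
        simp [this] at hd
      obtain ⟨d, rfl⟩ : ∃ d', d = d' + single i 1 := ⟨d - single i 1, by
        rw [tsub_add_cancel_of_le]; simpa using Nat.one_le_iff_ne_zero.2 hi⟩
      have hd' : d.degree = n := by simpa using hd
      rw [Finsupp.prod_add_index' (by simp) (by intros; rw [pow_add]),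
        Finsupp.prod_single_index (by simp), pow_one, mul_add, map_add, coeff_mul_X_eq,
        coeff_mul_X_eq]
      have side : ∀ s : ℕ ⊕ ℕ, (∀ e, leftPart (e + single s 1) + rightPart (e + single s 1) =
          leftPart e + rightPart e + single i 1) →
          (multiFact e : R) * (if e s = 0 then 0 else MvPowerSeries.coeff (e - single s 1)
          (d.prod fun s k => (MvPowerSeries.X (Sum.inl s) + MvPowerSeries.X (Sum.inr s) :
            MvPowerSeries (ℕ ⊕ ℕ) R) ^ k)) =
          e s * if leftPart e + rightPart e = d + single i 1 then (multiFact d : R) else 0 := by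
        intro s hs
        by_cases hes : e s = 0
        · simp [hes]
        · obtain ⟨e, rfl⟩ : ∃ e', e = e' + single s 1 := ⟨e - single s 1, by
            rw [tsub_add_cancel_of_le]; simpa using Nat.one_le_iff_ne_zero.2 hes⟩
          rw [if_neg hes, add_tsub_cancel_right, multiFact_add_single, hs, Nat.cast_mul, mul_assoc,
            ih d hd' e]
          simp
      rw [mul_add, side (Sum.inl i) (by intro e; simp; abel),
        side (Sum.inr i) (by intro e; simp; abel), ← add_mul]
      by_cases h : leftPart e + rightPart e = d + single i 1
      · rw [if_pos h, if_pos h, multiFact_add_single]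
        have := congrArg (fun x => x i) h
        simp only [Finsupp.add_apply, leftPart_apply, rightPart_apply, Finsupp.single_eq_same]
          at this
        rw [← Nat.cast_add, this, Nat.cast_mul]
      · rw [if_neg h, if_neg h, mul_zero]
  rw [MvPowerSeries.coeff_subst hasSubst_add, ← smul_eq_mul,
    smul_finsum' _ (MvPowerSeries.coeff_subst_finite hasSubst_add f e)]
  simp only [smul_eq_mul]
  simp only [mul_left_comm _ (MvPowerSeries.coeff _ f), key _ _ rfl]
  rw [finsum_eq_single _ (leftPart e + rightPart e)]
  · rw [if_pos rfl, mul_comm]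
  · intro d hd
    rw [if_neg hd.symm, mul_zero]

end Subst

/-- The coefficient form of `timeExp_inTimes`, in which `g` is the series `f(s)` in both sets of
variables and `h` is `f(s + γ)`: both sides solve the same linear system in `s` and in `γ`. -/
theorem timeExp_eq_of_divided_coeff {A : ℕ → Module.End ℂ Pol}
    (hA : ∀ i k, Commute (A i) (A k)) {f : (ℕ →₀ ℕ) → Pol} {g h : (ℕ ⊕ ℕ →₀ ℕ) → Pol}
    (hf : ∀ i α, coeffD i f α = A i (f α))
    (hin : ∀ e, g e = if rightPart e = 0 then f (leftPart e) else 0)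
    (hsh : ∀ e, (multiFact e : Pol) * h e =
      multiFact (leftPart e + rightPart e) * f (leftPart e + rightPart e)) :
    timeExp (Sum.elim (fun _ => 0) A) g = h := by
  have hcast : ∀ (n : ℕ) (p : Pol), (n : Pol) * p = (n : ℂ) • p := by
    intro n p
    rw [Algebra.smul_def, map_natCast]
  have hcomm : ∀ i k : ℕ ⊕ ℕ, Commute (Sum.elim (fun _ => 0) A i : Module.End ℂ Pol)
      (Sum.elim (fun _ => 0) A k) := by
    rintro (i | i) (k | k) <;> simp [hA]
  refine eq_of_coeffD_eq (A := Sum.elim A A) ?_ ?_ ?_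
  · rintro (i | i) e
    · rw [coeffD_timeExp hcomm]
      have h1 : coeffD (Sum.inl i) g = fun e => A i (g e) := by
        funext e
        rw [coeffD, hin, hin, rightPart_add, leftPart_add, rightPart_inl, leftPart_inl, add_zero]
        split_ifs
        · exact hf i (leftPart e)
        · simp
      rw [h1, ← timeExp_map (L := A i) (A := Sum.elim (fun _ => 0) A)]
      · simp
      · rintro (k | k) v
        · simp
        · exact congrArg (fun X : Module.End ℂ Pol => X v) (hA i k).eq
    · rw [coeffD_timeExp hcomm]
      have h1 : coeffD (Sum.inr i) g = fun e => (0 : Module.End ℂ Pol) (g e) := by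
        funext e
        rw [coeffD, hin, rightPart_add, rightPart_inr, if_neg]
        · simp
        · intro h
          simpa using congrArg (fun x : ℕ →₀ ℕ => x i) h
      rw [h1, ← timeExp_map (L := (0 : Module.End ℂ Pol)) (A := Sum.elim (fun _ => 0) A)]
      · simp
      · simp
  · have main : ∀ (i : ℕ) (s : ℕ ⊕ ℕ), (∀ e, leftPart (e + Finsupp.single s 1) +
        rightPart (e + Finsupp.single s 1) = leftPart e + rightPart e + Finsupp.single i 1) →
        ∀ e, coeffD s h e = A i (h e) := by
      intro i s hs e
      have h0 : (multiFact e : ℂ) ≠ 0 := by exact_mod_cast multiFact_ne_zero e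
      refine smul_right_injective Pol h0 ?_
      have h1 := hsh (e + Finsupp.single s 1)
      have h2 := hsh e
      rw [hcast, hcast] at h1 h2
      rw [hs, multiFact_add_single, multiFact_add_single] at h1
      dsimp only
      rw [← map_smul, h2, map_smul, ← hf]
      simp only [coeffD]
      push_cast at h1
      rw [smul_smul, mul_comm, h1, smul_smul, mul_comm]
      simp
    rintro (i | i) e
    · exact main i _ (by intro e; simp; abel) e
    · exact main i _ (by intro e; simp; abel) e
  · rw [timeExp_zero, hin]
    have h1 := hsh 0
    have h2 : leftPart 0 + rightPart 0 = 0 := by ext; simp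
    have h3 : leftPart 0 = 0 := by ext; simp
    have h4 : rightPart 0 = 0 := by ext; simp
    rw [h2, multiFact, multiFact] at h1
    simp only [Finsupp.prod_zero_index, Nat.cast_one, one_mul] at h1
    rw [h1, if_pos h4, h3]

/-- If the power series `f` solves `∂f / ∂s_i = A_i f` with commuting linear operators `A_i` on the
coefficients, then `e^{∑ γ_i A_i} f(s) = f(s + γ)`. -/
theorem timeExp_inTimes {A : ℕ → Module.End ℂ Pol} (hA : ∀ i k, Commute (A i) (A k))
    {f : MvPowerSeries ℕ Pol} (hf : ∀ i α, coeffD i f α = A i (f α)) :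
    timeExp (Sum.elim (fun _ => 0) A) (inTimes f) = shiftTimes f :=
  timeExp_eq_of_divided_coeff hA hf (coeff_subst_inl f) (coeff_subst_add f)

/-! ### The neutral fermions -/

open scoped symmDiff

/-- The coefficient of `φ_n`, apart from the sign `moveSign`, on a basis vector whose index set
contains `|n|` (`b` holds) or does not contain it (`b` fails). -/
def phiCoef (n : ℤ) (b : Prop) [Decidable b] : ℂ :=
  if b then (if 0 < n then 0 else if n = 0 then 1 / 2 else (-1) ^ n.natAbs)
  else if 0 ≤ n then 1 else 0

theorem symmDiff_singleton_of_mem {S : Finset ℕ} {m : ℕ} (h : m ∈ S) : S ∆ {m} = S.erase m := by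
  ext x
  by_cases hx : x = m <;> simp [Finset.mem_symmDiff, hx, h]

theorem symmDiff_singleton_of_notMem {S : Finset ℕ} {m : ℕ} (h : m ∉ S) :
    S ∆ {m} = insert m S := by
  ext x
  by_cases hx : x = m <;> simp [Finset.mem_symmDiff, hx, h]

/-- Each `φ_n` adds the element `|n|` to the index set of a basis vector or removes it. -/
theorem phi_single (n : ℤ) (S : Finset ℕ) (a : ℂ) :
    phi n (Finsupp.single S a) =
      Finsupp.single (S ∆ {n.natAbs}) (a * (phiCoef n (n.natAbs ∈ S) * moveSign S n.natAbs)) := by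
  have h1 : phi n (Finsupp.single S 1) = phiOnBasis n S := by
    have := fockBasis.constr_basis ℂ (phiOnBasis n) S
    rwa [Finsupp.coe_basisSingleOne] at this
  have h2 : (Finsupp.single S a : Fock) = a • Finsupp.single S 1 := by simp
  rw [h2, map_smul, h1, phiOnBasis, phiCoef]
  by_cases h : n.natAbs ∈ S
  · simp only [h, if_true]
    rw [symmDiff_singleton_of_mem h]
    split_ifs with h3 h4
    · simp
    · subst h4
      rw [Finsupp.smul_single, smul_eq_mul, Int.natAbs_zero, mul_comm (moveSign _ _)]
    · rw [Finsupp.smul_single, smul_eq_mul, mul_comm (moveSign _ _)]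
  · simp only [h, if_false]
    rw [symmDiff_singleton_of_notMem h]
    split_ifs <;> simp

theorem moveSign_mul_self (S : Finset ℕ) (m : ℕ) : moveSign S m * moveSign S m = 1 := by
  rw [moveSign, ← mul_pow]; simp

theorem moveSign_symmDiff_of_le {S : Finset ℕ} {m n : ℕ} (h : n ≤ m) :
    moveSign (S ∆ {n}) m = moveSign S m := by
  rw [moveSign, moveSign]
  congr 2
  ext x
  simp only [Finset.mem_filter, Finset.mem_symmDiff, Finset.mem_singleton]
  by_cases hx : x = n
  · subst hx; simp [Nat.not_lt.2 h]
  · simp [hx]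

theorem moveSign_symmDiff_of_lt {S : Finset ℕ} {m n : ℕ} (h : m < n) :
    moveSign (S ∆ {n}) m = -moveSign S m := by
  rw [moveSign, moveSign]
  by_cases hn : n ∈ S
  · rw [symmDiff_singleton_of_mem hn, Finset.filter_erase]
    have : n ∈ S.filter (m < ·) := by simp [hn, h]
    rw [← Finset.card_erase_add_one this, pow_succ]
    ring
  · rw [symmDiff_singleton_of_notMem hn, Finset.filter_insert, if_pos h,
      Finset.card_insert_of_notMem (by simp [hn]), pow_succ]
    ring

theorem phiCoef_congr {n : ℤ} {b c : Prop} [Decidable b] [Decidable c] (h : b ↔ c) :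
    phiCoef n b = phiCoef n c := by
  simp only [phiCoef, h]

theorem fock_ext {M : Type*} [AddCommGroup M] [Module ℂ M] {f g : Fock →ₗ[ℂ] M}
    (h : ∀ S, f (Finsupp.single S 1) = g (Finsupp.single S 1)) : f = g :=
  Finsupp.lhom_ext' fun S => LinearMap.ext_ring (h S)

/-- The canonical anticommutation relations. -/
theorem phi_anticomm (m n : ℤ) (v : Fock) :
    phi m (phi n v) + phi n (phi m v) = (if m + n = 0 then (-1 : ℂ) ^ m else 0) • v := by
  suffices h : phi m * phi n + phi n * phi m =
      (if m + n = 0 then (-1 : ℂ) ^ m else 0) • (1 : Module.End ℂ Fock) from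
    congrArg (fun X : Module.End ℂ Fock => X v) h
  refine fock_ext fun S => ?_
  simp only [LinearMap.add_apply, Module.End.mul_apply, phi_single, LinearMap.smul_apply,
    Module.End.one_apply, Finsupp.smul_single, smul_eq_mul, mul_one, one_mul]
  by_cases hmn : m.natAbs = n.natAbs
  · rw [hmn, symmDiff_assoc, symmDiff_self, Finset.bot_eq_empty, ← Finset.bot_eq_empty,
      symmDiff_bot, moveSign_symmDiff_of_le le_rfl, ← Finsupp.single_add]
    congr 1
    have hmem : n.natAbs ∈ S ∆ {n.natAbs} ↔ ¬ n.natAbs ∈ S := by simp [Finset.mem_symmDiff]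
    rw [phiCoef_congr hmem, phiCoef_congr hmem]
    have hs := moveSign_mul_self S n.natAbs
    generalize moveSign S n.natAbs = s at hs
    have h1 : ∀ x y z w : ℂ, x * s * (y * s) + z * s * (w * s) = x * y + z * w := by
      intro x y z w
      linear_combination (x * y + z * w) * hs
    rw [h1]
    have hpow : ∀ k : ℕ, (-1 : ℂ) ^ (-(k : ℤ)) = (-1) ^ k := by
      intro k; rw [zpow_neg, zpow_natCast, ← inv_pow]; norm_num
    by_cases hmem' : n.natAbs ∈ S
    all_goals
      simp only [phiCoef, hmem', not_true, not_false_iff, if_true, if_false]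
      rcases Int.natAbs_eq_natAbs_iff.1 hmn with rfl | rfl
      · rcases lt_trichotomy m 0 with h | h | h
        · simp [h.not_ge, h.not_gt, h.ne]
        · subst h; norm_num
        · simp [h, h.le, h.ne']
      · rcases lt_trichotomy n 0 with h | h | h
        · obtain ⟨k, rfl⟩ : ∃ k : ℕ, n = -k := ⟨n.natAbs, by omega⟩
          have hk : 0 < k := by omega
          have hk' : ¬ ((k : ℤ) < 0) := by omega
          simp [hk, hk', hk.ne']
        · subst h; norm_num
        · obtain ⟨k, rfl⟩ : ∃ k : ℕ, n = k := ⟨n.natAbs, by omega⟩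
          have hk : 0 < k := by omega
          have hk' : ¬ ((k : ℤ) < 0) := by omega
          simp [hk, hk', hk.ne', hpow]
  · have h0 : m + n ≠ 0 := by omega
    rw [if_neg h0]
    have hm : m.natAbs ∈ S ∆ {n.natAbs} ↔ m.natAbs ∈ S := by simp [Finset.mem_symmDiff, hmn]
    have hn : n.natAbs ∈ S ∆ {m.natAbs} ↔ n.natAbs ∈ S := by
      simp [Finset.mem_symmDiff, Ne.symm hmn]
    rw [phiCoef_congr hm, phiCoef_congr hn, symmDiff_right_comm,
      ← Finsupp.single_add, Finsupp.single_zero, Finsupp.single_eq_zero]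
    rcases Nat.lt_or_gt_of_ne hmn with h | h
    · rw [moveSign_symmDiff_of_lt h, moveSign_symmDiff_of_le h.le]; ring
    · rw [moveSign_symmDiff_of_lt h, moveSign_symmDiff_of_le h.le]; ring

theorem phi_anticomm' {m n : ℤ} (h : m + n ≠ 0) (v : Fock) :
    phi m (phi n v) = -phi n (phi m v) := by
  have := phi_anticomm m n v
  rw [if_neg h, zero_smul] at this
  exact eq_neg_of_add_eq_zero_left this

theorem phi_zero_zero (v : Fock) : phi 0 (phi 0 v) = (1 / 2 : ℂ) • v := by
  have := phi_anticomm 0 0 v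
  simp only [add_zero, if_true, zpow_zero, one_smul] at this
  rw [← two_smul ℂ] at this
  conv_rhs => rw [← this, smul_smul]
  norm_num

theorem phi_vac {n : ℤ} (h : n < 0) : phi n vac = 0 := by
  simp [vac, phi_single, phiCoef, h.not_ge]

theorem vacL_phi {n : ℤ} (h : 0 < n) (v : Fock) : vacL (phi n v) = 0 := by
  suffices vacL ∘ₗ phi n = 0 from LinearMap.congr_fun this v
  refine fock_ext fun S => ?_
  by_cases hS : n.natAbs ∈ S
  · simp [phi_single, hS, phiCoef, h]
  · rw [LinearMap.comp_apply, phi_single, symmDiff_singleton_of_notMem hS]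
    simp [vacL, Finset.insert_ne_empty]

theorem vacL_vac : vacL vac = 1 := by simp [vacL, vac]

theorem phi_single_of_max {a : ℕ} {S : Finset ℕ} (hS : ∀ x ∈ S, x < a) :
    phi a (Finsupp.single S 1) = Finsupp.single (insert a S) 1 := by
  have haS : a ∉ S := fun ha => lt_irrefl _ (hS a ha)
  rw [phi_single, Int.natAbs_natCast, symmDiff_singleton_of_notMem haS]
  have : S.filter (a < ·) = ∅ := Finset.filter_eq_empty_iff.2 fun x hx => (hS x hx).not_gt
  simp [phiCoef, haS, moveSign, this]

/-- A linear map on the Fock space is determined by its value on the vacuum and the way it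
propagates through the creation operators `φ_n`, `n ≥ 0`. -/
theorem fock_ext_of_phi {M : Type*} [AddCommGroup M] [Module ℂ M] {f g : Fock →ₗ[ℂ] M}
    (h0 : f vac = g vac) (h : ∀ n : ℕ, ∀ v, f v = g v → f (phi n v) = g (phi n v)) : f = g := by
  refine fock_ext fun S => ?_
  induction S using Finset.induction_on_max with
  | empty => exact h0
  | insert a S hS ih =>
    rw [← phi_single_of_max hS]
    exact h a _ ih

/-! ### The energy filtration -/

/-- The vectors of energy at most `N`: the span of the basis vectors indexed by the sets with sum
at most `N`. -/
def energyLE (N : ℤ) : Submodule ℂ Fock :=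
  Finsupp.supported ℂ ℂ {S : Finset ℕ | (∑ s ∈ S, (s : ℤ)) ≤ N}

theorem energyLE_mono {N N' : ℤ} (h : N ≤ N') : energyLE N ≤ energyLE N' :=
  Finsupp.supported_mono fun _ hS => le_trans hS h

theorem eq_zero_of_mem_energyLE {N : ℤ} (hN : N < 0) {v : Fock} (hv : v ∈ energyLE N) : v = 0 := by
  rw [energyLE, Finsupp.mem_supported] at hv
  rw [← Finsupp.support_eq_empty, Finset.eq_empty_iff_forall_notMem]
  intro S hS
  have h1 : (∑ s ∈ S, (s : ℤ)) ≤ N := hv hS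
  have h2 : (0 : ℤ) ≤ ∑ s ∈ S, (s : ℤ) := Finset.sum_nonneg fun _ _ => by positivity
  omega

theorem exists_mem_energyLE (v : Fock) : ∃ N : ℕ, v ∈ energyLE N := by
  refine ⟨v.support.sup fun S => ∑ s ∈ S, s, ?_⟩
  rw [energyLE, Finsupp.mem_supported]
  intro S hS
  have := Finset.le_sup (f := fun S : Finset ℕ => ∑ s ∈ S, s) hS
  have h2 : ((∑ s ∈ S, s : ℕ) : ℤ) ≤ (v.support.sup fun S => ∑ s ∈ S, s : ℕ) := by
    exact_mod_cast this
  simpa using h2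

theorem phi_mem_energyLE (n : ℤ) {N : ℤ} {v : Fock} (hv : v ∈ energyLE N) :
    phi n v ∈ energyLE (N + n) := by
  have : energyLE N ≤ (energyLE (N + n)).comap (phi n) := by
    rw [energyLE, Finsupp.supported_eq_span_single, Submodule.span_le]
    rintro _ ⟨S, hS, rfl⟩
    change phi n _ ∈ energyLE (N + n)
    have hS' : (∑ s ∈ S, (s : ℤ)) ≤ N := hS
    rw [phi_single]
    by_cases hn : n.natAbs ∈ S
    · by_cases h0 : 0 < n
      · simp [phiCoef, hn, h0]
      · refine Finsupp.single_mem_supported ℂ _ ?_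
        rw [Set.mem_ofPred_eq]
        rw [symmDiff_singleton_of_mem hn]
        have := Finset.sum_erase_add S (fun s : ℕ => (s : ℤ)) hn
        omega
    · by_cases h0 : 0 ≤ n
      · refine Finsupp.single_mem_supported ℂ _ ?_
        rw [Set.mem_ofPred_eq]
        rw [symmDiff_singleton_of_notMem hn, Finset.sum_insert hn]
        omega
      · simp [phiCoef, hn, h0]
  exact this hv

theorem phi_eq_zero_of_lt {n N : ℤ} {v : Fock} (hv : v ∈ energyLE N) (h : n < -N) :
    phi n v = 0 :=
  eq_zero_of_mem_energyLE (by omega) (phi_mem_energyLE n hv)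

/-! ### Quadratic operators -/

/-- The quadratic operator `∑_n a(n) φ_n φ_{k-n}`. The sum is finite on every vector for `k ≠ 0`
only; `H_n` has `k = -n` and `B_k` has this `k`. -/
def quad (k : ℤ) (a : ℤ → ℂ) : Module.End ℂ Fock :=
  opSum fockBasis fun n : ℤ => a n • (phi n * phi (k - n))

theorem phi_phi_finite {k : ℤ} (hk : k ≠ 0) (v : Fock) :
    {n : ℤ | phi n (phi (k - n) v) ≠ 0}.Finite := by
  obtain ⟨N, hN⟩ := exists_mem_energyLE v
  refine (Set.finite_Icc (-(N : ℤ)) (N + k)).subset fun n hn => ?_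
  rw [Set.mem_ofPred_eq] at hn
  constructor
  · by_contra! h
    apply hn
    rw [phi_anticomm' (by omega), phi_eq_zero_of_lt hN h, map_zero, neg_zero]
  · by_contra! h
    apply hn
    rw [phi_eq_zero_of_lt hN (by omega : k - n < -N), map_zero]

theorem quad_finite {k : ℤ} (hk : k ≠ 0) (a : ℤ → ℂ) (v : Fock) :
    {n : ℤ | (a n • (phi n * phi (k - n))) v ≠ 0}.Finite := by
  refine (phi_phi_finite hk v).subset fun n hn h => hn ?_
  rw [LinearMap.smul_apply, Module.End.mul_apply, h, smul_zero]

theorem quad_finite' {k : ℤ} (hk : k ≠ 0) (a : ℤ → ℂ) (v : Fock) :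
    (fun n : ℤ => a n • phi n (phi (k - n) v)).HasFiniteSupport :=
  quad_finite hk a v

theorem quad_apply {k : ℤ} (hk : k ≠ 0) (a : ℤ → ℂ) (v : Fock) :
    quad k a v = ∑ᶠ n : ℤ, a n • phi n (phi (k - n) v) :=
  opSum_apply fockBasis (quad_finite hk a) v

/-- A quadratic operator acts on the fermions by a shift of the index: moving `φ_j` through
`φ_n φ_{k-n}` leaves a contraction at `n = k + j` and one at `n = -j`. -/
theorem quad_phi {k : ℤ} (hk : k ≠ 0) (a : ℤ → ℂ) (j : ℤ) (v : Fock) :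
    quad k a (phi j v) = phi j (quad k a v) +
      ((-1) ^ j * (a (k + j) - a (-j))) • phi (k + j) v := by
  have h1 : ∀ n, a n • phi n (phi (k - n) (phi j v)) =
      phi j (a n • phi n (phi (k - n) v)) +
      ((if n = k + j then ((-1) ^ j * a (k + j)) • phi (k + j) v else 0) +
      (if n = -j then (-((-1) ^ j * a (-j))) • phi (k + j) v else 0)) := by
    intro n
    have e1 := phi_anticomm (k - n) j v
    have e2 := phi_anticomm n j (phi (k - n) v)
    have e3 : phi n (phi (k - n) (phi j v)) = phi j (phi n (phi (k - n) v)) +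
        ((if k - n + j = 0 then (-1 : ℂ) ^ (k - n) else 0) • phi n v -
        (if n + j = 0 then (-1 : ℂ) ^ n else 0) • phi (k - n) v) := by
      rw [eq_sub_of_add_eq e1, map_sub, map_smul, eq_sub_of_add_eq e2]
      abel
    have hneg : (-1 : ℂ) ^ (-j) = (-1) ^ j := by
      rw [zpow_neg, ← inv_zpow]; norm_num
    rw [e3, smul_add, map_smul, smul_sub, sub_eq_add_neg (a n • _)]
    congr 2
    · by_cases h : n = k + j
      · subst h
        rw [if_pos (by ring), if_pos rfl, smul_smul, show k - (k + j) = -j by ring, hneg, mul_comm]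
      · rw [if_neg (by omega), if_neg h, zero_smul, smul_zero]
    · by_cases h : n = -j
      · subst h
        rw [if_pos (by ring), if_pos rfl, hneg, smul_smul, neg_smul, sub_neg_eq_add, mul_comm]
      · rw [if_neg (by omega), if_neg h, zero_smul, smul_zero, neg_zero]
  rw [quad_apply hk, quad_apply hk, finsum_congr h1, finsum_add_distrib, finsum_add_distrib,
    finsum_eq_single (fun n => if n = k + j then _ else _) (k + j) fun n hn => if_neg hn,
    finsum_eq_single (fun n => if n = -j then _ else _) (-j) fun n hn => if_neg hn,
    if_pos rfl, if_pos rfl, ← add_smul, ← map_finsum (phi j) (quad_finite' hk a v)]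
  · congr 2; ring
  · exact (Set.finite_singleton (k + j)).subset fun n hn => by
      by_contra h; exact hn (if_neg h)
  · exact (Set.finite_singleton (-j)).subset fun n hn => by
      by_contra h; exact hn (if_neg h)
  · refine (quad_finite hk a v).subset fun n hn h => hn ?_
    have : a n • phi n (phi (k - n) v) = 0 := h
    simp only [this, map_zero]
  · refine (Set.Finite.union (Set.finite_singleton (k + j)) (Set.finite_singleton (-j))).subset
      fun n hn => ?_
    by_contra h
    simp only [Set.singleton_union, Set.mem_insert_iff, Set.mem_singleton_iff, not_or] at h
    exact hn (by simp [h.1, h.2])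

theorem quad_mem_energyLE {k : ℤ} (hk : k ≠ 0) (a : ℤ → ℂ) {N : ℤ} {v : Fock}
    (hv : v ∈ energyLE N) : quad k a v ∈ energyLE (N + k) := by
  rw [quad_apply hk]
  refine finsum_induction (· ∈ energyLE (N + k)) (zero_mem _) (fun _ _ => add_mem) fun n => ?_
  refine Submodule.smul_mem _ _ ?_
  have := phi_mem_energyLE n (phi_mem_energyLE (k - n) hv)
  rwa [show N + (k - n) + n = N + k by ring] at this

theorem vacL_quad {k : ℤ} (hk : 0 < k) (a : ℤ → ℂ) (v : Fock) : vacL (quad k a v) = 0 := by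
  rw [quad_apply hk.ne', map_finsum vacL (quad_finite' hk.ne' a v)]
  refine (finsum_congr fun n => ?_).trans finsum_zero
  rw [map_smul]
  rcases lt_or_ge 0 n with h | h
  · rw [vacL_phi h, smul_zero]
  · rw [phi_anticomm' (by omega), map_neg, vacL_phi (by omega), neg_zero, smul_zero]

theorem quad_vac {k : ℤ} (hk : k < 0) (a : ℤ → ℂ) : quad k a vac = 0 := by
  have h : vac ∈ energyLE 0 := Finsupp.single_mem_supported ℂ _ (by simp)
  exact eq_zero_of_mem_energyLE (by omega) (quad_mem_energyLE hk.ne a h)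

/-! ### Parity and the scalar operators -/

/-- The operator acting on the standard basis of the Fock space by the scalars `d S`. -/
def diagOp (d : Finset ℕ → ℂ) : Module.End ℂ Fock :=
  fockBasis.constr ℂ fun S => Finsupp.single S (d S)

theorem diagOp_single (d : Finset ℕ → ℂ) (S : Finset ℕ) (a : ℂ) :
    diagOp d (Finsupp.single S a) = Finsupp.single S (a * d S) := by
  have h1 : diagOp d (Finsupp.single S 1) = Finsupp.single S (d S) := by
    have := fockBasis.constr_basis ℂ (fun S => (Finsupp.single S (d S) : Fock)) S
    rwa [Finsupp.coe_basisSingleOne] at this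
  have h2 : (Finsupp.single S a : Fock) = a • Finsupp.single S 1 := by simp
  rw [h2, map_smul, h1]; simp

/-- The fermion parity operator `(-1)^F`. -/
def parity : Module.End ℂ Fock := diagOp fun S => (-1) ^ S.card

theorem parity_single (S : Finset ℕ) (a : ℂ) :
    parity (Finsupp.single S a) = Finsupp.single S (a * (-1) ^ S.card) :=
  diagOp_single _ S a

theorem parity_phi (n : ℤ) (v : Fock) : parity (phi n v) = -phi n (parity v) := by
  suffices h : parity * phi n = -(phi n * parity) from
    congrArg (fun X : Module.End ℂ Fock => X v) h
  refine fock_ext fun S => ?_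
  have hcard : (-1 : ℂ) ^ (S ∆ {n.natAbs}).card = -(-1) ^ S.card := by
    by_cases hn : n.natAbs ∈ S
    · rw [symmDiff_singleton_of_mem hn, ← Finset.card_erase_add_one hn, pow_succ]
      ring
    · rw [symmDiff_singleton_of_notMem hn, Finset.card_insert_of_notMem hn, pow_succ]
      ring
  simp only [Module.End.mul_apply, LinearMap.neg_apply, phi_single, parity_single, hcard,
    ← Finsupp.single_neg]
  congr 1; ring

theorem parity_vac : parity vac = vac := by simp [vac, parity_single]

theorem parity_quad {k : ℤ} (hk : k ≠ 0) (a : ℤ → ℂ) (v : Fock) :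
    parity (quad k a v) = quad k a (parity v) := by
  rw [quad_apply hk, quad_apply hk, map_finsum parity (quad_finite' hk a v)]
  refine finsum_congr fun n => ?_
  rw [map_smul, parity_phi, parity_phi, map_neg, neg_neg]

/-- A vector annihilated by `φ_{-m}`, `m > 0`, has no component along the basis vectors that contain
`m`. -/
theorem apply_eq_zero_of_phi_eq_zero {v : Fock} {m : ℕ} (hm : 0 < m) (hv : phi (-m) v = 0)
    {S : Finset ℕ} (hS : m ∈ S) : v S = 0 := by
  have key : ∀ u : Fock, phi (-m) u (S.erase m) = (moveSign S m * (-1) ^ m) * u S := by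
    intro u
    suffices h : Finsupp.lapply (S.erase m) ∘ₗ phi (-m) =
        (moveSign S m * (-1) ^ m) • (Finsupp.lapply S : Fock →ₗ[ℂ] ℂ) from
      LinearMap.congr_fun h u
    refine fock_ext fun U => ?_
    simp only [LinearMap.comp_apply, phi_single, Int.natAbs_neg, Int.natAbs_natCast, one_mul,
      Finsupp.lapply_apply, LinearMap.smul_apply, smul_eq_mul]
    by_cases hU : m ∈ U
    · rw [symmDiff_singleton_of_mem hU]
      by_cases hUS : U = S
      · subst hUS
        simp [phiCoef, hU, hm.ne', mul_comm]
      · rw [Finsupp.single_eq_of_ne, Finsupp.single_eq_of_ne, mul_zero]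
        · exact Ne.symm hUS
        · intro h
          apply hUS
          rw [← Finset.insert_erase hU, ← h, Finset.insert_erase hS]
    · have hUS : S ≠ U := fun h => hU (h ▸ hS)
      simp [phiCoef, hU, hm.ne', Finsupp.single_eq_of_ne hUS]
  have h1 := key v
  rw [hv, Finsupp.zero_apply, eq_comm, mul_eq_zero] at h1
  rcases h1 with h | h
  · exact absurd h (by simp [moveSign])
  · exact h

/-- An even operator commuting with all fermions is a scalar (Schur's lemma). -/
theorem eq_scalar_of_commute_phi {C : Module.End ℂ Fock} (hC : ∀ n v, C (phi n v) = phi n (C v))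
    (hP : parity (C vac) = C vac) : C = vacL (C vac) • 1 := by
  -- `C|0⟩` is annihilated by all `φ_{-m}`, `m > 0`, so it lies in the span of `|0⟩` and `φ_0 |0⟩`,
  -- and parity excludes the second vector.
  have hvac : C vac = vacL (C vac) • vac := by
    ext S
    by_cases hS : S = ∅
    · subst hS; simp [vacL, vac]
    · have hv0 : vac S = 0 := Finsupp.single_eq_of_ne hS
      rw [Finsupp.smul_apply, hv0, smul_zero]
      by_cases h : ∃ m ∈ S, 0 < m
      · obtain ⟨m, hm, h0⟩ := h
        refine apply_eq_zero_of_phi_eq_zero h0 ?_ hm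
        rw [← hC, phi_vac (by omega), map_zero]
      · push Not at h
        have hS0 : S = {0} := by
          refine Finset.eq_singleton_iff_nonempty_unique_mem.2
            ⟨Finset.nonempty_iff_ne_empty.2 hS, fun m hm => Nat.le_zero.1 (h m hm)⟩
        have hpar : ∀ u : Fock, parity u {0} = -u {0} := by
          intro u
          suffices h : Finsupp.lapply {0} ∘ₗ parity = -(Finsupp.lapply {0} : Fock →ₗ[ℂ] ℂ) from
            LinearMap.congr_fun h u
          refine fock_ext fun U => ?_
          simp only [LinearMap.comp_apply, parity_single, one_mul, Finsupp.lapply_apply,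
            LinearMap.neg_apply]
          by_cases hU : U = {0}
          · subst hU; simp
          · simp [Finsupp.single_eq_of_ne (Ne.symm hU)]
        have := hpar (C vac)
        rw [hP] at this
        rw [hS0]
        linear_combination this / 2
  refine fock_ext_of_phi (by simpa using hvac) fun n v hv => ?_
  rw [hC, hv]
  simp

/-- Two quadratic operators whose actions on the fermions commute have a scalar commutator. -/
theorem quad_comm {k l : ℤ} (hk : k ≠ 0) (hl : l ≠ 0) {a b : ℤ → ℂ} {x y : ℤ → ℂ}
    (hx : ∀ j, (-1) ^ j * (a (k + j) - a (-j)) = x j)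
    (hy : ∀ j, (-1) ^ j * (b (l + j) - b (-j)) = y j)
    (hxy : ∀ j, y j * x (l + j) = x j * y (k + j)) (v : Fock) :
    quad k a (quad l b v) = quad l b (quad k a v) +
      vacL (quad k a (quad l b vac) - quad l b (quad k a vac)) • v := by
  have h := eq_scalar_of_commute_phi (C := quad k a * quad l b - quad l b * quad k a) ?_ ?_
  · have := congrArg (fun X : Module.End ℂ Fock => X v) h
    simp only [LinearMap.sub_apply, Module.End.mul_apply, LinearMap.smul_apply,
      Module.End.one_apply] at this
    rw [← this]; abel
  · intro j v
    simp only [LinearMap.sub_apply, Module.End.mul_apply, quad_phi hk, quad_phi hl, map_add,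
      map_smul, hx, hy, map_sub, smul_add, smul_smul]
    rw [hxy, show k + (l + j) = l + (k + j) by ring]
    abel
  · simp only [LinearMap.sub_apply, Module.End.mul_apply, map_sub, parity_quad hk, parity_quad hl,
      parity_vac]

/-! ### Exponentials of power series in one variable -/

section Euler

variable {A : Type*} [Ring A] [Algebra ℂ A]

/-- The Euler operator `z d/dz` on power series. -/
def eulerD (F : PowerSeries A) : PowerSeries A := PowerSeries.mk fun n => (n : ℂ) • F.coeff n

@[simp] theorem coeff_eulerD (F : PowerSeries A) (n : ℕ) :
    (eulerD F).coeff n = (n : ℂ) • F.coeff n := PowerSeries.coeff_mk _ _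

theorem eulerD_sub (F G : PowerSeries A) : eulerD (F - G) = eulerD F - eulerD G := by
  ext n; simp [smul_sub]

theorem eulerD_mul (F G : PowerSeries A) : eulerD (F * G) = eulerD F * G + F * eulerD G := by
  ext n
  simp only [coeff_eulerD, map_add, PowerSeries.coeff_mul, Finset.smul_sum,
    ← Finset.sum_add_distrib]
  refine Finset.sum_congr rfl fun x hx => ?_
  rw [← Finset.HasAntidiagonal.mem_antidiagonal.1 hx, smul_mul_assoc, mul_smul_comm,
    ← add_smul, Nat.cast_add]

/-- A solution of `z F' = Ξ F` with `Ξ(0) = 0` and `F(0) = 0` vanishes. -/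
theorem eq_zero_of_eulerD_eq {F Ξ : PowerSeries A} (hΞ : Ξ.coeff 0 = 0) (hF : eulerD F = Ξ * F)
    (h0 : F.coeff 0 = 0) : F = 0 := by
  ext n
  rw [map_zero]
  induction n using Nat.strong_induction_on with
  | _ n ih =>
    rcases Nat.eq_zero_or_pos n with rfl | hn
    · exact h0
    · have h := congrArg (PowerSeries.coeff n) hF
      rw [coeff_eulerD, PowerSeries.coeff_mul, Finset.sum_eq_zero] at h
      · exact (smul_eq_zero.1 h).resolve_left (by exact_mod_cast hn.ne')
      · rintro ⟨p, q⟩ hpq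
        have hpq' : p + q = n := Finset.HasAntidiagonal.mem_antidiagonal.1 hpq
        rcases Nat.eq_zero_or_pos p with rfl | hp
        · simp only [hΞ, zero_mul]
        · simp only [ih q (by omega), mul_zero]

theorem commute_of_coeff {R : Type*} [Ring R] {F G : PowerSeries R}
    (h : ∀ m n, Commute (F.coeff m) (G.coeff n)) :
    Commute F G := by
  ext n
  rw [PowerSeries.coeff_mul, PowerSeries.coeff_mul, ← Finset.Nat.sum_antidiagonal_swap]
  exact Finset.sum_congr rfl fun x _ => (h _ _).eq

theorem eulerD_pow {F : PowerSeries A} (h : Commute F (eulerD F)) (j : ℕ) :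
    eulerD (F ^ j) = (j : ℂ) • (eulerD F * F ^ (j - 1)) := by
  induction j with
  | zero =>
    ext n
    rw [coeff_eulerD, pow_zero, PowerSeries.coeff_one]
    split_ifs with hn <;> simp [hn]
  | succ j ih =>
    rw [pow_succ', eulerD_mul, ih, Nat.add_sub_cancel, mul_smul_comm, ← mul_assoc, h.eq, mul_assoc]
    rcases j with _ | j
    · simp
    · rw [Nat.add_sub_cancel, ← pow_succ']
      push_cast
      simp only [add_smul, one_smul]
      abel

theorem coeff_xi (s : ℕ → A) (n : ℕ) : (xi s).coeff n = if Odd n then s (n / 2) else 0 :=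
  PowerSeries.coeff_mk _ _

theorem coeff_xi_pow_of_lt (s : ℕ → A) {n j : ℕ} (h : n < j) : (xi s ^ j).coeff n = 0 := by
  induction j generalizing n with
  | zero => omega
  | succ j ih =>
    rw [pow_succ, PowerSeries.coeff_mul]
    refine Finset.sum_eq_zero ?_
    rintro ⟨p, q⟩ hpq
    have hpq' : p + q = n := Finset.HasAntidiagonal.mem_antidiagonal.1 hpq
    rcases Nat.eq_zero_or_pos q with rfl | hq
    · simp [coeff_xi]
    · simp only [ih (by omega : p < j), zero_mul]

/-- The power series `e^{ξ(s, z)}`. -/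
def expXi (s : ℕ → A) : PowerSeries A := PowerSeries.mk (expXiCoeff s)

@[simp] theorem coeff_expXi (s : ℕ → A) (n : ℕ) : (expXi s).coeff n = expXiCoeff s n :=
  PowerSeries.coeff_mk _ _

theorem expXiCoeff_eq_sum (s : ℕ → A) {a M : ℕ} (h : a < M) :
    expXiCoeff s a = ∑ j ∈ Finset.range M, ((Nat.factorial j : ℂ)⁻¹) • (xi s ^ j).coeff a := by
  refine Finset.sum_subset (Finset.range_mono (by omega)) fun j _ hj => ?_
  rw [coeff_xi_pow_of_lt s (by simpa using hj), smul_zero]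

theorem expXiCoeff_zero_right (s : ℕ → A) : expXiCoeff s 0 = 1 := by
  simp [expXiCoeff]

/-- For commuting times, `z d/dz e^{ξ(s, z)} = (z d/dz ξ(s, z)) e^{ξ(s, z)}`. -/
theorem eulerD_expXi {s : ℕ → A} (hs : ∀ i j, Commute (s i) (s j)) :
    eulerD (expXi s) = eulerD (xi s) * expXi s := by
  have hcomm : Commute (xi s) (eulerD (xi s)) := by
    refine commute_of_coeff fun m n => ?_
    rw [coeff_eulerD, coeff_xi, coeff_xi]
    refine Commute.smul_right ?_ _
    split_ifs
    exacts [hs _ _, Commute.zero_right _, Commute.zero_left _, Commute.zero_left _]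
  ext n
  have h1 : (eulerD (xi s) * expXi s).coeff n =
      (eulerD (xi s) * ∑ j ∈ Finset.range n, ((Nat.factorial j : ℂ)⁻¹) • xi s ^ j).coeff n := by
    rw [PowerSeries.coeff_mul, PowerSeries.coeff_mul]
    refine Finset.sum_congr rfl ?_
    rintro ⟨p, q⟩ hpq
    have hpq' : p + q = n := Finset.HasAntidiagonal.mem_antidiagonal.1 hpq
    rcases Nat.eq_zero_or_pos p with rfl | hp
    · simp
    · simp only [coeff_expXi]
      rw [expXiCoeff_eq_sum s (by omega : q < n), map_sum]
      rfl
  rw [h1, coeff_eulerD, coeff_expXi, expXiCoeff, Finset.smul_sum, Finset.sum_range_succ',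
    Finset.mul_sum, map_sum]
  have h2 : (n : ℂ) • ((Nat.factorial 0 : ℂ)⁻¹) • (xi s ^ 0).coeff n = 0 := by
    rw [pow_zero, PowerSeries.coeff_one]
    split_ifs with h <;> simp [h]
  rw [h2, add_zero]
  refine Finset.sum_congr rfl fun j _ => ?_
  have h3 := congrArg (PowerSeries.coeff n) (eulerD_pow hcomm (j + 1))
  rw [coeff_eulerD, Nat.add_sub_cancel] at h3
  have h4 : ∀ (c : ℂ) (F : PowerSeries A), (c • F).coeff n = c • F.coeff n := fun _ _ => rfl
  rw [smul_comm, h3, mul_smul_comm, h4, h4, smul_smul]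
  congr 1
  rw [Nat.factorial_succ]
  have h5 : (Nat.factorial j : ℂ) ≠ 0 := by exact_mod_cast Nat.factorial_ne_zero j
  have h6 : (j : ℂ) + 1 ≠ 0 := Nat.cast_add_one_ne_zero j
  push_cast
  field_simp

end Euler

section Intertwine

variable {M N : Type*} [AddCommGroup M] [Module ℂ M] [AddCommGroup N] [Module ℂ N]

/-- Coefficients of `e^{ξ(s, z)}` for intertwined operators are intertwined. -/
theorem expXiCoeff_map {L : M →ₗ[ℂ] N} {s : ℕ → Module.End ℂ M} {s' : ℕ → Module.End ℂ N}
    (h : ∀ i v, L (s i v) = s' i (L v)) (a : ℕ) (v : M) :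
    L (expXiCoeff s a v) = expXiCoeff s' a (L v) := by
  have key : ∀ j a v, L ((xi s ^ j).coeff a v) = (xi s' ^ j).coeff a (L v) := by
    intro j
    induction j with
    | zero =>
      intro a v
      rw [pow_zero, pow_zero, PowerSeries.coeff_one, PowerSeries.coeff_one]
      split_ifs <;> simp
    | succ j ih =>
      intro a v
      rw [pow_succ, pow_succ, PowerSeries.coeff_mul, PowerSeries.coeff_mul]
      simp only [LinearMap.sum_apply, map_sum, Module.End.mul_apply, ih, coeff_xi]
      refine Finset.sum_congr rfl fun x _ => ?_
      split_ifs
      · rw [h]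
      · simp
  simp only [expXiCoeff, LinearMap.sum_apply, map_sum, LinearMap.smul_apply, map_smul, key]

theorem expXiCoeff_zero_left (a : ℕ) :
    expXiCoeff (fun _ => (0 : Module.End ℂ M)) a = if a = 0 then 1 else 0 := by
  have h : xi (fun _ => (0 : Module.End ℂ M)) = 0 := by
    ext n : 1
    simp [coeff_xi]
  rw [expXiCoeff, Finset.sum_range_succ', h]
  simp [PowerSeries.coeff_one]

/-- A vector killed by all times is fixed by `e^{ξ(s, z)}`. -/
theorem expXiCoeff_apply_of_eq_zero {s : ℕ → Module.End ℂ M} {v : M} (h : ∀ i, s i v = 0)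
    (a : ℕ) : expXiCoeff s a v = if a = 0 then v else 0 := by
  have := expXiCoeff_map (L := LinearMap.toSpanSingleton ℂ M v) (s := fun _ => 0) (s' := s)
    (by intro i c; simp [h]) a 1
  rw [LinearMap.toSpanSingleton_apply, LinearMap.toSpanSingleton_apply, one_smul,
    expXiCoeff_zero_left] at this
  rw [← this]
  split_ifs <;> simp

end Intertwine

/-- The generators `e^{ξ(t, z)} = ∑ q_a z^a` satisfy `∂ q_a / ∂t_n = q_{a-n}`. -/
theorem pderiv_expXiCoeff (i a : ℕ) :
    MvPolynomial.pderiv i (expXiCoeff (fun i => (MvPolynomial.X i : Pol)) a) =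
      if 2 * i + 1 ≤ a then expXiCoeff (fun i => (MvPolynomial.X i : Pol)) (a - (2 * i + 1))
      else 0 := by
  set s : ℕ → Pol := fun i => MvPolynomial.X i
  let δ : PowerSeries Pol → PowerSeries Pol := fun F =>
    PowerSeries.mk fun n => MvPolynomial.pderiv i (F.coeff n)
  have hδ : ∀ F n, (δ F).coeff n = MvPolynomial.pderiv i (F.coeff n) := fun F n =>
    PowerSeries.coeff_mk _ _
  have hδmul : ∀ F G, δ (F * G) = δ F * G + F * δ G := by
    intro F G
    ext n : 1
    rw [hδ, map_add, PowerSeries.coeff_mul, PowerSeries.coeff_mul, PowerSeries.coeff_mul, map_sum,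
      ← Finset.sum_add_distrib]
    refine Finset.sum_congr rfl fun x _ => ?_
    rw [Derivation.leibniz, hδ, hδ, smul_eq_mul, smul_eq_mul]
    ring
  have hδE : ∀ F, δ (eulerD F) = eulerD (δ F) := by
    intro F
    ext n : 1
    simp [hδ]
  set Y : PowerSeries Pol := PowerSeries.X ^ (2 * i + 1) with hY
  have hξ : δ (xi s) = Y := by
    ext n : 1
    rw [hδ, coeff_xi, hY, PowerSeries.coeff_X_pow]
    by_cases hn : Odd n
    · rw [if_pos hn, MvPolynomial.pderiv_X]
      have : n / 2 = i ↔ n = 2 * i + 1 := by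
        obtain ⟨m, rfl⟩ := hn; omega
      by_cases h : n = 2 * i + 1
      · rw [if_pos h, this.2 h, Pi.single_eq_same]
      · rw [if_neg h, Pi.single_eq_of_ne (fun h' => h (this.1 h'))]
    · rw [if_neg hn, map_zero, if_neg]
      rintro rfl
      exact hn ⟨i, rfl⟩
  have hE := eulerD_expXi (s := s) fun _ _ => Commute.all _ _
  have hG : δ (expXi s) - Y * expXi s = 0 := by
    refine eq_zero_of_eulerD_eq (Ξ := eulerD (xi s)) (by simp) ?_ ?_
    · rw [eulerD_sub, eulerD_mul, ← hδE, hE, hδmul, hδE, hξ]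
      ring
    · rw [map_sub, hδ, coeff_expXi, expXiCoeff_zero_right]
      simp [hY]
  have h := congrArg (PowerSeries.coeff a) (sub_eq_zero.1 hG)
  rw [hδ, hY, PowerSeries.coeff_X_pow_mul', coeff_expXi, coeff_expXi] at h
  exact h

theorem constantCoeff_expXiCoeff (a : ℕ) :
    MvPolynomial.constantCoeff (expXiCoeff (fun i => (MvPolynomial.X i : Pol)) a) =
      if a = 0 then 1 else 0 := by
  have key : ∀ j a, 0 < j → MvPolynomial.constantCoeff
      ((xi (fun i => (MvPolynomial.X i : Pol)) ^ j).coeff a) = 0 := by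
    intro j a hj
    obtain ⟨j, rfl⟩ : ∃ j', j = j' + 1 := ⟨j - 1, by omega⟩
    rw [pow_succ, PowerSeries.coeff_mul, map_sum]
    refine Finset.sum_eq_zero fun x _ => ?_
    rw [map_mul, coeff_xi]
    split_ifs <;> simp
  rw [expXiCoeff, Finset.sum_range_succ', map_add, map_sum, Finset.sum_eq_zero]
  · simp only [pow_zero, PowerSeries.coeff_one]
    split_ifs <;> simp
  · intro j _
    rw [Algebra.smul_def, map_mul, key _ _ (Nat.succ_pos j), mul_zero]

/-! ### The Heisenberg algebra -/

theorem ham_eq_quad (n : ℤ) : ham n = quad (-n) fun k => (1 / 2 : ℂ) * (-1) ^ (k + 1) := by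
  have h : (fun k : ℤ => ((1 / 2 : ℂ) * (-1) ^ (k + 1)) • (phi k * phi (-k - n))) =
      fun k : ℤ => ((1 / 2 : ℂ) * (-1) ^ (k + 1)) • (phi k * phi (-n - k)) :=
    funext fun k => by rw [show -k - n = -n - k by ring]
  exact congrArg (opSum fockBasis) h

theorem neg_one_zpow_odd {n : ℤ} (h : Odd n) : (-1 : ℂ) ^ n = -1 := Odd.neg_one_zpow h

theorem neg_one_zpow_neg (n : ℤ) : (-1 : ℂ) ^ (-n) = (-1) ^ n := by
  rw [zpow_neg, ← inv_zpow]; norm_num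

theorem neg_one_zpow_add (m n : ℤ) : (-1 : ℂ) ^ (m + n) = (-1) ^ m * (-1) ^ n :=
  zpow_add₀ (by norm_num) m n

theorem neg_one_zpow_mul_self (n : ℤ) : (-1 : ℂ) ^ n * (-1) ^ n = 1 := by
  rw [← mul_zpow]; simp

theorem odd_ne_zero {n : ℤ} (h : Odd n) : n ≠ 0 := by
  rintro rfl; simp at h

theorem ham_phi_coef {n : ℤ} (hn : Odd n) (j : ℤ) :
    (-1 : ℂ) ^ j * ((1 / 2 : ℂ) * (-1) ^ (-n + j + 1) - (1 / 2 : ℂ) * (-1) ^ (-j + 1)) = 1 := by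
  rw [neg_one_zpow_add, neg_one_zpow_add, neg_one_zpow_add (-j), neg_one_zpow_neg,
    neg_one_zpow_neg, neg_one_zpow_odd hn, zpow_one]
  linear_combination neg_one_zpow_mul_self j

/-- `[H_n, φ_j] = φ_{j-n}`. -/
theorem ham_phi {n : ℤ} (hn : Odd n) (j : ℤ) (v : Fock) :
    ham n (phi j v) = phi j (ham n v) + phi (j - n) v := by
  rw [ham_eq_quad, quad_phi (neg_ne_zero.2 (odd_ne_zero hn)), ham_phi_coef hn, one_smul,
    show -n + j = j - n by ring]

theorem ham_vac {n : ℤ} (hn : 0 < n) : ham n vac = 0 := by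
  rw [ham_eq_quad, quad_vac (by omega)]

theorem ham_mem_energyLE {n : ℤ} (hn : Odd n) {N : ℤ} {v : Fock} (hv : v ∈ energyLE N) :
    ham n v ∈ energyLE (N - n) := by
  rw [ham_eq_quad]
  exact quad_mem_energyLE (neg_ne_zero.2 (odd_ne_zero hn)) _ hv

theorem parity_ham {n : ℤ} (hn : Odd n) (v : Fock) : parity (ham n v) = ham n (parity v) := by
  rw [ham_eq_quad, parity_quad (neg_ne_zero.2 (odd_ne_zero hn))]

/-- The commutator of two Hamiltonians is the scalar given by its vacuum expectation value. -/
theorem ham_comm_aux {m n : ℤ} (hm : Odd m) (hn : Odd n) (v : Fock) :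
    ham m (ham n v) = ham n (ham m v) +
      vacL (ham m (ham n vac) - ham n (ham m vac)) • v := by
  rw [ham_eq_quad, ham_eq_quad]
  exact quad_comm (neg_ne_zero.2 (odd_ne_zero hm)) (neg_ne_zero.2 (odd_ne_zero hn))
    (x := fun _ => 1) (y := fun _ => 1) (ham_phi_coef hm) (ham_phi_coef hn) (fun _ => rfl) v

theorem ham_comm {m n : ℤ} (hm : Odd m) (hn : Odd n) (hm0 : 0 < m) (hn0 : 0 < n) (v : Fock) :
    ham m (ham n v) = ham n (ham m v) := by
  rw [ham_comm_aux hm hn, ham_vac hm0, ham_vac hn0]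
  simp

/-- The vacuum expectation value `⟨0| φ_a φ_b |0⟩` vanishes unless `a + b = 0`. -/
theorem vacL_phi_phi_vac_of_ne {a b : ℤ} (h : a + b ≠ 0) : vacL (phi a (phi b vac)) = 0 := by
  rcases lt_trichotomy a 0 with ha | rfl | ha
  · rw [phi_anticomm' h, phi_vac ha, map_zero, neg_zero, map_zero]
  · rcases lt_trichotomy b 0 with hb | rfl | hb
    · rw [phi_vac hb, map_zero, map_zero]
    · omega
    · rw [phi_anticomm' h, map_neg, vacL_phi hb, neg_zero]
  · exact vacL_phi ha _

theorem vacL_phi_phi_vac (a : ℤ) : vacL (phi a (phi (-a) vac)) =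
    if 0 < a then 0 else if a = 0 then 1 / 2 else (-1) ^ a := by
  split_ifs with h h0
  · exact vacL_phi h _
  · subst h0
    rw [neg_zero, phi_zero_zero, map_smul, vacL_vac]; simp
  · have := phi_anticomm a (-a) vac
    rw [phi_vac (by omega : a < 0), map_zero, add_zero, if_pos (by ring)] at this
    rw [this, map_smul, vacL_vac]; simp

/-- The central term of the Heisenberg algebra, as a vacuum expectation value. -/
theorem vacL_ham_ham_neg_vac {m n : ℤ} (hm : Odd m) (hn : Odd n) (hm0 : 0 < m) (hn0 : 0 < n) :
    vacL (ham m (ham (-n) vac)) = if m = n then (n : ℂ) / 2 else 0 := by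
  have h1 : ham (-n) vac = ∑ᶠ k : ℤ, ((1 / 2 : ℂ) * (-1) ^ (k + 1)) • phi k (phi (n - k) vac) := by
    rw [ham_eq_quad, neg_neg, quad_apply hn0.ne']
  have h2 : ∀ k, vacL (ham m (((1 / 2 : ℂ) * (-1) ^ (k + 1)) • phi k (phi (n - k) vac))) =
      ((1 / 2 : ℂ) * (-1) ^ (k + 1)) *
        (vacL (phi k (phi (n - k - m) vac)) + vacL (phi (k - m) (phi (n - k) vac))) := by
    intro k
    rw [map_smul, map_smul, ham_phi hm, ham_phi hm, ham_vac hm0, map_zero, zero_add, map_add,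
      smul_eq_mul]
  have h3 : vacL (ham m (ham (-n) vac)) = ∑ᶠ k : ℤ, ((1 / 2 : ℂ) * (-1) ^ (k + 1)) *
        (vacL (phi k (phi (n - k - m) vac)) + vacL (phi (k - m) (phi (n - k) vac))) := by
    rw [h1, ← LinearMap.comp_apply, map_finsum (vacL ∘ₗ ham m) (quad_finite' hn0.ne' _ vac)]
    exact finsum_congr h2
  rw [h3]
  split_ifs with hmn
  · subst hmn
    obtain ⟨l, hl⟩ : ∃ l : ℕ, m = l + 1 := ⟨(m - 1).toNat, by omega⟩
    -- The contractions leave `1 / 2` for each `0 < k < m` and half of that at the two ends, where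
    -- `φ_0` is paired with itself.
    have h4 : ∀ k : ℤ, ((1 / 2 : ℂ) * (-1) ^ (k + 1)) *
        (vacL (phi k (phi (m - k - m) vac)) + vacL (phi (k - m) (phi (m - k) vac))) =
        if k < 0 ∨ m < k then 0 else if k = 0 ∨ k = m then 1 / 4 else 1 / 2 := by
      intro k
      rw [show m - k - m = -k by ring, show m - k = -(k - m) by ring, vacL_phi_phi_vac,
        vacL_phi_phi_vac, neg_one_zpow_add, sub_eq_add_neg k m, neg_one_zpow_add, neg_one_zpow_neg,
        neg_one_zpow_odd hm, zpow_one]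
      have hs := neg_one_zpow_mul_self k
      rcases lt_trichotomy k 0 with h | rfl | h
      · rw [if_neg (by omega), if_neg (by omega), if_neg (by omega), if_neg (by omega),
          if_pos (by omega)]
        ring
      · rw [if_neg (by omega), if_pos rfl, if_neg (by omega), if_neg (by omega),
          if_neg (by omega), if_pos (by omega), zpow_zero]
        norm_num
      · rcases lt_trichotomy k m with h' | rfl | h'
        · rw [if_pos h, if_neg (by omega), if_neg (by omega), if_neg (by omega), if_neg (by omega)]
          linear_combination hs / 2
        · rw [if_pos h, if_neg (by omega), if_pos (by omega), if_neg (by omega),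
            if_pos (by omega), neg_one_zpow_odd hm]
          norm_num
        · rw [if_pos h, if_pos (by omega), if_pos (by omega)]
          ring
    rw [finsum_congr h4, finsum_eq_sum_of_support_subset (s := (Finset.range (l + 2)).map
      Nat.castEmbedding) _ ?_, Finset.sum_map, Finset.sum_range_succ, Finset.sum_range_succ']
    · have h5 : ∀ k ∈ Finset.range l, (if ((Nat.castEmbedding (k + 1) : ℤ)) < 0 ∨
          m < Nat.castEmbedding (k + 1) then (0 : ℂ) else
          if (Nat.castEmbedding (k + 1) : ℤ) = 0 ∨ (Nat.castEmbedding (k + 1) : ℤ) = m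
            then 1 / 4 else 1 / 2) = 1 / 2 := by
        intro k hk
        have := Finset.mem_range.1 hk
        rw [Nat.castEmbedding_apply, if_neg (by push_cast; omega), if_neg (by push_cast; omega)]
      rw [Finset.sum_congr rfl h5]
      simp only [Nat.castEmbedding_apply]
      have h6 : ¬ (((0 : ℕ) : ℤ) < 0 ∨ m < ((0 : ℕ) : ℤ)) := by omega
      have h7 : ¬ (((l + 1 : ℕ) : ℤ) < 0 ∨ m < ((l + 1 : ℕ) : ℤ)) := by omega
      have h8 : ((l + 1 : ℕ) : ℤ) = 0 ∨ ((l + 1 : ℕ) : ℤ) = m := by omega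
      rw [if_neg h6, if_pos (Or.inl Nat.cast_zero), if_neg h7, if_pos h8, hl]
      simp
      ring
    · intro k hk
      rw [Function.mem_support] at hk
      have : ¬ (k < 0 ∨ m < k) := fun h => hk (if_pos h)
      simp only [Finset.coe_map, Set.mem_image, Finset.coe_range, Set.mem_Iio,
        Nat.castEmbedding_apply]
      exact ⟨k.toNat, by omega, by omega⟩
  · refine (finsum_congr fun k => ?_).trans finsum_zero
    rw [vacL_phi_phi_vac_of_ne (by omega), vacL_phi_phi_vac_of_ne (by omega)]
    simp

/-- `[H_m, H_{-n}] = (n / 2) δ_{mn}` for positive odd `m`, `n`. -/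
theorem ham_ham_neg {m n : ℤ} (hm : Odd m) (hn : Odd n) (hm0 : 0 < m) (hn0 : 0 < n) (v : Fock) :
    ham m (ham (-n) v) = ham (-n) (ham m v) + (if m = n then (n : ℂ) / 2 else 0) • v := by
  rw [ham_comm_aux hm hn.neg, ham_vac hm0, map_zero, sub_zero, vacL_ham_ham_neg_vac hm hn hm0 hn0]

theorem vacL_ham_neg {n : ℤ} (hn0 : 0 < n) (v : Fock) : vacL (ham (-n) v) = 0 := by
  rw [ham_eq_quad, neg_neg, vacL_quad hn0]

theorem odd_time (i : ℕ) : Odd (2 * (i : ℤ) + 1) := ⟨i, rfl⟩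

/-! ### Polynomials and their derivatives -/

/-- A space of polynomials which is stable under the partial derivatives and whose members have
no constant term is zero. -/
theorem pol_eq_zero {S : Submodule ℂ Pol} (h0 : ∀ p ∈ S, MvPolynomial.constantCoeff p = 0)
    (hd : ∀ i, ∀ p ∈ S, MvPolynomial.pderiv i p ∈ S) {p : Pol} (hp : p ∈ S) : p = 0 := by
  have key : ∀ (n : ℕ) (d : ℕ →₀ ℕ), d.degree = n → ∀ p ∈ S, MvPolynomial.coeff d p = 0 := by
    intro n
    induction n with
    | zero => intro d hd p hp; rw [(Finsupp.degree_eq_zero_iff d).1 hd]; exact h0 p hp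
    | succ n ih =>
      intro d hd' p hp
      obtain ⟨i, hi⟩ : ∃ i, d i ≠ 0 := by
        by_contra! hcon
        have : d = 0 := Finsupp.ext hcon
        simp [this] at hd'
      obtain ⟨d, rfl⟩ : ∃ e, d = e + Finsupp.single i 1 := ⟨d - Finsupp.single i 1, by
        rw [tsub_add_cancel_of_le]; simpa using Nat.one_le_iff_ne_zero.2 hi⟩
      have h1 := ih d (by simpa using hd') _ (hd i p hp)
      rw [MvPolynomial.coeff_pderiv] at h1
      exact (mul_eq_zero.1 h1).resolve_right (Nat.cast_add_one_ne_zero _)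
  ext d
  exact key _ d rfl p hp

theorem pderiv_comm (i k : ℕ) (p : Pol) :
    MvPolynomial.pderiv i (MvPolynomial.pderiv k p) =
      MvPolynomial.pderiv k (MvPolynomial.pderiv i p) := by
  ext d
  simp only [MvPolynomial.coeff_pderiv]
  rw [add_right_comm d]
  by_cases h : i = k
  · subst h; rfl
  · simp [h, Ne.symm h]
    ring

/-- The partial derivative with respect to the time with index `i` as a linear map. -/
abbrev dT (i : ℕ) : Pol →ₗ[ℂ] Pol := (MvPolynomial.pderiv i : Derivation ℂ Pol Pol)

/-! ### Covectors evolved by the Hamiltonian flow -/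

/-- The covector `ω e^{H(t)}` for a covector `ω` on the Fock space. -/
def expH (ω : Fock →ₗ[ℂ] ℂ) : Fock →ₗ[ℂ] Pol :=
  opSum fockBasis fun j : ℕ =>
    ((Nat.factorial j : ℂ)⁻¹) • (actH^[j] (Algebra.linearMap ℂ Pol ∘ₗ ω))

theorem ham_time_eq_zero {N : ℕ} {v : Fock} (hv : v ∈ energyLE N) {i : ℕ} (hi : N < 2 * i + 1) :
    ham (2 * i + 1) v = 0 :=
  eq_zero_of_mem_energyLE (by omega) (ham_mem_energyLE (odd_time i) hv)

theorem ham_time_finite (v : Fock) : {i : ℕ | ham (2 * i + 1) v ≠ 0}.Finite := by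
  obtain ⟨N, hN⟩ := exists_mem_energyLE v
  refine (Set.finite_Iic N).subset fun i hi => ?_
  by_contra h
  rw [Set.mem_Iic] at h
  exact hi (ham_time_eq_zero hN (by omega))

theorem actH_finite (ω : Fock →ₗ[ℂ] Pol) (v : Fock) :
    (fun i : ℕ => (MvPolynomial.X i : Pol) * ω (ham (2 * i + 1) v)).HasFiniteSupport := by
  refine (ham_time_finite v).subset fun i hi h => hi ?_
  simp only [h, map_zero, mul_zero]

theorem actH_apply (ω : Fock →ₗ[ℂ] Pol) (v : Fock) :
    actH ω v = ∑ᶠ i : ℕ, (MvPolynomial.X i : Pol) * ω (ham (2 * i + 1) v) :=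
  opSum_apply fockBasis (A := fun i : ℕ =>
    (LinearMap.mulLeft ℂ (MvPolynomial.X i : Pol)) ∘ₗ ω ∘ₗ ham (2 * i + 1)) (actH_finite ω) v

theorem actH_comp_ham (ω : Fock →ₗ[ℂ] Pol) (i : ℕ) (v : Fock) :
    actH (ω ∘ₗ ham (2 * i + 1)) v = actH ω (ham (2 * i + 1) v) := by
  rw [actH_apply, actH_apply]
  refine finsum_congr fun k => ?_
  rw [LinearMap.comp_apply, ham_comm (odd_time i) (odd_time k) (by omega) (by omega)]

theorem pderiv_actH (ω : Fock →ₗ[ℂ] Pol) (i : ℕ) (v : Fock) :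
    MvPolynomial.pderiv i (actH ω v) = ω (ham (2 * i + 1) v) + actH (dT i ∘ₗ ω) v := by
  rw [actH_apply, actH_apply, ← Derivation.coeFn_coe, map_finsum (dT i) (actH_finite ω v)]
  have h1 : ∀ k, dT i ((MvPolynomial.X k : Pol) * ω (ham (2 * k + 1) v)) =
      (if k = i then ω (ham (2 * i + 1) v) else 0) +
        (MvPolynomial.X k : Pol) * (dT i ∘ₗ ω) (ham (2 * k + 1) v) := by
    intro k
    rw [dT, Derivation.coeFn_coe, Derivation.leibniz, MvPolynomial.pderiv_X, add_comm]
    by_cases h : k = i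
    · subst h; simp
    · simp [h]
  rw [finsum_congr h1, finsum_add_distrib _ (actH_finite _ v),
    finsum_eq_single (fun k => if k = i then _ else _) i fun k hk => if_neg hk, if_pos rfl]
  exact (Set.finite_singleton i).subset fun k hk => by
    by_contra h; exact hk (if_neg h)

theorem actH_smul (c : ℂ) (ω : Fock →ₗ[ℂ] Pol) (v : Fock) : actH (c • ω) v = c • actH ω v := by
  rw [actH_apply, actH_apply, smul_finsum]
  refine finsum_congr fun k => ?_
  rw [LinearMap.smul_apply, mul_smul_comm]

/-- As the `H_n` commute, `∂ / ∂t_n (ω H(t)^j) = j ω H(t)^{j-1} H_n`. For `j = 0` both sides vanish,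
whatever the truncated `j - 1`. -/
theorem pderiv_actH_iterate (ω : Fock →ₗ[ℂ] ℂ) (j i : ℕ) (v : Fock) :
    MvPolynomial.pderiv i (actH^[j] (Algebra.linearMap ℂ Pol ∘ₗ ω) v) =
      (j : ℂ) • actH^[j - 1] (Algebra.linearMap ℂ Pol ∘ₗ ω) (ham (2 * i + 1) v) := by
  induction j generalizing v with
  | zero => simp
  | succ j ih =>
    rw [Function.iterate_succ_apply', pderiv_actH, Nat.add_sub_cancel]
    have h1 : dT i ∘ₗ actH^[j] (Algebra.linearMap ℂ Pol ∘ₗ ω) =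
        (j : ℂ) • (actH^[j - 1] (Algebra.linearMap ℂ Pol ∘ₗ ω) ∘ₗ ham (2 * i + 1)) :=
      LinearMap.ext ih
    rw [h1, actH_smul, actH_comp_ham]
    push_cast
    rw [add_smul, one_smul, add_comm]
    congr 1
    rcases j with _ | j
    · simp
    · rw [Nat.add_sub_cancel, ← Function.iterate_succ_apply' actH]

theorem actH_iterate_eq_zero (ω : Fock →ₗ[ℂ] Pol) {j : ℕ} {N : ℤ} {v : Fock}
    (hv : v ∈ energyLE N) (hj : N < j) : actH^[j] ω v = 0 := by
  induction j generalizing v N with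
  | zero => rw [eq_zero_of_mem_energyLE (by simpa using hj) hv, map_zero]
  | succ j ih =>
    rw [Function.iterate_succ_apply', actH_apply]
    refine (finsum_congr fun i => ?_).trans finsum_zero
    rw [ih (ham_mem_energyLE (odd_time i) hv) (by push_cast at hj; omega), mul_zero]

theorem expH_apply (ω : Fock →ₗ[ℂ] ℂ) {N : ℤ} {v : Fock} (hv : v ∈ energyLE N) {M : ℕ}
    (hM : N < M) : expH ω v = ∑ j ∈ Finset.range M,
      ((Nat.factorial j : ℂ)⁻¹) • actH^[j] (Algebra.linearMap ℂ Pol ∘ₗ ω) v := by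
  have hz : ∀ {N : ℤ} {v : Fock}, v ∈ energyLE N → ∀ {j : ℕ}, N < j →
      (((Nat.factorial j : ℂ)⁻¹) • actH^[j] (Algebra.linearMap ℂ Pol ∘ₗ ω)) v = 0 := by
    intro N v hv j hj
    rw [LinearMap.smul_apply, actH_iterate_eq_zero _ hv hj, smul_zero]
  rw [expH, opSum_apply]
  · refine finsum_eq_sum_of_support_subset _ fun j hj => ?_
    by_contra h
    simp only [Finset.coe_range, Set.mem_Iio, not_lt] at h
    exact hj (hz hv (by omega))
  · intro u
    obtain ⟨K, hK⟩ := exists_mem_energyLE u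
    refine (Set.finite_Iic K).subset fun j hj => ?_
    by_contra h
    rw [Set.mem_Iic] at h
    exact hj (hz hK (by omega))

/-- `∂ / ∂t_n (ω e^{H(t)}) = ω e^{H(t)} H_n`. -/
theorem pderiv_expH (ω : Fock →ₗ[ℂ] ℂ) (i : ℕ) (v : Fock) :
    MvPolynomial.pderiv i (expH ω v) = expH ω (ham (2 * i + 1) v) := by
  obtain ⟨N, hN⟩ := exists_mem_energyLE v
  have hN' : ham (2 * i + 1) v ∈ energyLE N :=
    energyLE_mono (by omega) (ham_mem_energyLE (odd_time i) hN)
  rw [expH_apply ω hN (M := N + 2) (by push_cast; omega),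
    expH_apply ω hN' (M := N + 1) (by push_cast; omega), map_sum, Finset.sum_range_succ']
  have h0 : MvPolynomial.pderiv i (((Nat.factorial 0 : ℂ)⁻¹) •
      actH^[0] (Algebra.linearMap ℂ Pol ∘ₗ ω) v) = 0 := by
    rw [Derivation.map_smul, pderiv_actH_iterate]; simp
  rw [h0, add_zero]
  refine Finset.sum_congr rfl fun j _ => ?_
  rw [Derivation.map_smul, pderiv_actH_iterate, Nat.add_sub_cancel, smul_smul]
  congr 1
  rw [Nat.factorial_succ]
  have h5 : (Nat.factorial j : ℂ) ≠ 0 := by exact_mod_cast Nat.factorial_ne_zero j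
  have h6 : (j : ℂ) + 1 ≠ 0 := Nat.cast_add_one_ne_zero j
  push_cast
  field_simp

theorem constantCoeff_expH (ω : Fock →ₗ[ℂ] ℂ) (v : Fock) :
    MvPolynomial.constantCoeff (expH ω v) = ω v := by
  obtain ⟨N, hN⟩ := exists_mem_energyLE v
  rw [expH_apply ω hN (M := N + 1) (by push_cast; omega), Finset.sum_range_succ', map_add, map_sum,
    Finset.sum_eq_zero]
  · simp
  · intro j _
    have : MvPolynomial.constantCoeff
        (actH^[j + 1] (Algebra.linearMap ℂ Pol ∘ₗ ω) v) = 0 := by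
      rw [Function.iterate_succ_apply', actH_apply,
        map_finsum MvPolynomial.constantCoeff (actH_finite _ v)]
      refine (finsum_congr fun i => ?_).trans finsum_zero
      simp
    rw [Algebra.smul_def, map_mul, this, mul_zero]

/-- If `f` is a linear map into the polynomials with the properties of `ω e^{H(t)}`, then it is
`ω e^{H(t)}`. -/
theorem eq_expH {ω : Fock →ₗ[ℂ] ℂ} {f : Fock →ₗ[ℂ] Pol}
    (h0 : ∀ v, MvPolynomial.constantCoeff (f v) = ω v)
    (hd : ∀ i v, MvPolynomial.pderiv i (f v) = f (ham (2 * i + 1) v)) : f = expH ω := by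
  refine LinearMap.ext fun v => ?_
  rw [← sub_eq_zero]
  refine pol_eq_zero (S := LinearMap.range (f - expH ω)) ?_ ?_ ⟨v, rfl⟩
  · rintro _ ⟨u, rfl⟩
    rw [LinearMap.sub_apply, map_sub, h0, constantCoeff_expH, sub_self]
  · rintro i _ ⟨u, rfl⟩
    rw [LinearMap.sub_apply, map_sub, hd, pderiv_expH]
    exact ⟨_, rfl⟩

theorem vacExpH_eq : vacExpH = expH vacL := rfl

/-- The negative modes act on `⟨0| e^{H(t)}` as multiplication operators. -/
theorem vacExpH_ham_neg (i : ℕ) (v : Fock) : vacExpH (ham (-(2 * i + 1)) v) =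
    ((2 * i + 1 : ℂ) / 2) • ((MvPolynomial.X i : Pol) * vacExpH v) := by
  rw [vacExpH_eq, ← sub_eq_zero]
  refine pol_eq_zero (S := LinearMap.range (expH vacL ∘ₗ ham (-(2 * i + 1)) -
    ((2 * i + 1 : ℂ) / 2) • (LinearMap.mulLeft ℂ (MvPolynomial.X i : Pol) ∘ₗ expH vacL)))
    ?_ ?_ ⟨v, rfl⟩
  · rintro _ ⟨u, rfl⟩
    rw [LinearMap.sub_apply, map_sub, LinearMap.comp_apply, constantCoeff_expH,
      vacL_ham_neg (by omega)]
    simp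
  · rintro k _ ⟨u, rfl⟩
    refine ⟨ham (2 * k + 1) u, ?_⟩
    simp only [LinearMap.sub_apply, LinearMap.comp_apply, LinearMap.smul_apply,
      LinearMap.mulLeft_apply, map_sub, Derivation.map_smul, Derivation.leibniz, pderiv_expH,
      MvPolynomial.pderiv_X]
    rw [ham_ham_neg (odd_time k) (odd_time i) (by omega) (by omega)]
    by_cases h : i = k
    · subst h
      simp
    · have h' : ¬ (2 * (k : ℤ) + 1 = 2 * i + 1) := by omega
      simp [h', h]

theorem vacExpH_vac : vacExpH vac = 1 := by
  have h : vac ∈ energyLE 0 := Finsupp.single_mem_supported ℂ _ (by simp)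
  rw [vacExpH_eq, expH_apply vacL h (M := 1) (by simp)]
  simp [vacL_vac]

/-- Every polynomial is a matrix element `⟨0| e^{H(t)} v`. -/
theorem vacExpH_surjective : Function.Surjective vacExpH := by
  intro p
  induction p using MvPolynomial.induction_on with
  | C a =>
    refine ⟨a • vac, ?_⟩
    rw [map_smul, vacExpH_vac, Algebra.smul_def, mul_one]; rfl
  | add p q hp hq =>
    obtain ⟨u, rfl⟩ := hp
    obtain ⟨v, rfl⟩ := hq
    exact ⟨u + v, map_add _ _ _⟩
  | mul_X p i hp =>
    obtain ⟨u, rfl⟩ := hp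
    refine ⟨((2 * i + 1 : ℂ) / 2)⁻¹ • ham (-(2 * i + 1)) u, ?_⟩
    rw [map_smul, vacExpH_ham_neg, smul_smul, inv_mul_cancel₀, one_smul, mul_comm]
    have : (2 * (i : ℂ) + 1) ≠ 0 := by exact_mod_cast Nat.succ_ne_zero (2 * i)
    exact div_ne_zero this two_ne_zero

/-! ### Half vertex operators -/

section HalfVertex

variable {M : Type*} [AddCommGroup M] [Module ℂ M]

/-- If the time with number `n` lowers a filtration by `n`, then the coefficient of `z ^ b` in
`e^{ξ(s, z)}` lowers it by `b`. -/
theorem expXiCoeff_mem {F : ℤ → Submodule ℂ M} {s : ℕ → Module.End ℂ M}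
    (hs : ∀ (i : ℕ) (N : ℤ), ∀ v ∈ F N, s i v ∈ F (N - (2 * i + 1))) {N : ℤ} {v : M} (hv : v ∈ F N)
    (b : ℕ) :
    expXiCoeff s b v ∈ F (N - b) := by
  have key : ∀ (j b : ℕ) (N : ℤ) (v : M), v ∈ F N → (xi s ^ j).coeff b v ∈ F (N - b) := by
    intro j
    induction j with
    | zero =>
      intro b N v hv
      rw [pow_zero, PowerSeries.coeff_one]
      split_ifs with h
      · subst h; simpa using hv
      · exact zero_mem _
    | succ j ih =>
      intro b N v hv
      rw [pow_succ, PowerSeries.coeff_mul, LinearMap.sum_apply]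
      refine Submodule.sum_mem _ fun x hx => ?_
      have hx' := Finset.HasAntidiagonal.mem_antidiagonal.1 hx
      rw [Module.End.mul_apply, coeff_xi]
      split_ifs with h
      · have h1 := hs (x.2 / 2) N v hv
        obtain ⟨m, hm⟩ := h
        have h3 := ih x.1 _ _ h1
        rwa [show N - (2 * ((x.2 / 2 : ℕ) : ℤ) + 1) - x.1 = N - b by omega] at h3
      · simp
  rw [expXiCoeff, LinearMap.sum_apply]
  exact Submodule.sum_mem _ fun j _ => Submodule.smul_mem _ _ (key j b N v hv)

/-- The coefficients of `(1 - x) / (1 + x) = 1 - 2 x + 2 x² - ⋯ = exp (-2 ∑ xⁿ / n)`, `n` odd. -/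
def kappa (a : ℕ) : ℂ := if a = 0 then 1 else 2 * (-1) ^ a

theorem sum_kappa (n : ℕ) :
    (∑ x ∈ Finset.HasAntidiagonal.antidiagonal n, if Odd x.1 then -2 * kappa x.2 else 0) =
      n * kappa n := by
  induction n using Nat.twoStepInduction with
  | zero => simp
  | one => simp [Finset.Nat.sum_antidiagonal_succ, kappa]
  | more n ih _ =>
    rw [Finset.Nat.sum_antidiagonal_succ, Finset.Nat.sum_antidiagonal_succ]
    have h : ∀ x : ℕ × ℕ, (if Odd (x.1 + 1 + 1) then -2 * kappa x.2 else 0) =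
        if Odd x.1 then -2 * kappa x.2 else 0 := by
      intro x
      have : Odd (x.1 + 1 + 1) ↔ Odd x.1 := by
        rw [add_assoc]; exact Nat.odd_add.trans (by simp)
      simp only [this]
    simp only [h, ih]
    rcases n with _ | n
    · simp [kappa]
    · simp [kappa, pow_succ]; ring

/-- Let commuting operators `h_n` (`n` odd) act on a family `f` by the shifts
`[h_n, f_j] = f_{j-n}`. Then, with `f(y) = ∑ f_j y^j`,
`e^{-2 ∑ h_n x^n / n} f(y) = (1 - x y) / (1 + x y) f(y) e^{-2 ∑ h_n x^n / n}`. -/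
theorem expXiCoeff_apply_shift {h s : ℕ → Module.End ℂ M} {f : ℤ → Module.End ℂ M}
    (hs : s = fun i : ℕ => (-2 / (2 * i + 1) : ℂ) • h i)
    (hh : ∀ i k, Commute (h i) (h k))
    (hf : ∀ i j v, h i (f j v) = f j (h i v) + f (j - (2 * i + 1)) v) (b : ℕ) (j : ℤ) (v : M) :
    expXiCoeff s b (f j v) = ∑ x ∈ Finset.HasAntidiagonal.antidiagonal b,
      kappa x.1 • f (j - x.1) (expXiCoeff s x.2 v) := by
  let Φ : PowerSeries (Module.End ℂ M) := PowerSeries.mk fun a => kappa a • f (j - a)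
  have hΦ : ∀ a, Φ.coeff a = kappa a • f (j - a) := fun a => PowerSeries.coeff_mk _ _
  have hΞ : ∀ p, (eulerD (xi s)).coeff p = if Odd p then (-2 : ℂ) • h (p / 2) else 0 := by
    intro p
    rw [coeff_eulerD, coeff_xi]
    split_ifs with hp
    · obtain ⟨m, rfl⟩ := hp
      rw [hs, smul_smul, show (2 * m + 1) / 2 = m by omega]
      have : (2 * (m : ℂ) + 1) ≠ 0 := by exact_mod_cast Nat.succ_ne_zero (2 * m)
      push_cast
      congr 1
      field_simp
    · simp
  have hE : eulerD (expXi s) = eulerD (xi s) * expXi s :=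
    eulerD_expXi fun i k => by rw [hs]; exact ((hh i k).smul_right _).smul_left _
  have hC : eulerD (PowerSeries.C (f j)) = 0 := by
    ext n : 1
    rw [coeff_eulerD, PowerSeries.coeff_C]
    split_ifs with h <;> simp [h]
  have hcomm : eulerD (xi s) * Φ = Φ * eulerD (xi s) + eulerD Φ := by
    ext n : 1
    rw [map_add, PowerSeries.coeff_mul, PowerSeries.coeff_mul, ← Finset.Nat.sum_antidiagonal_swap,
      coeff_eulerD, hΦ, smul_smul, ← sum_kappa, Finset.sum_smul,
      ← Finset.Nat.sum_antidiagonal_swap (f := fun x : ℕ × ℕ =>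
        (if Odd x.1 then -2 * kappa x.2 else 0) • f (j - n)), ← Finset.sum_add_distrib]
    refine Finset.sum_congr rfl fun x hx => ?_
    have hx' := Finset.HasAntidiagonal.mem_antidiagonal.1 hx
    simp only [Prod.fst_swap, Prod.snd_swap, hΦ, hΞ]
    split_ifs with hodd
    · refine LinearMap.ext fun u => ?_
      simp only [Module.End.mul_apply, LinearMap.smul_apply, LinearMap.add_apply, map_smul]
      obtain ⟨m, hm⟩ := hodd
      have hidx : j - (x.1 : ℤ) - (2 * ((x.2 / 2 : ℕ) : ℤ) + 1) = j - n := by omega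
      rw [hf, hidx]
      simp only [smul_add, smul_smul, mul_comm]
    · simp
  have hG : expXi s * PowerSeries.C (f j) - Φ * expXi s = 0 := by
    refine eq_zero_of_eulerD_eq (Ξ := eulerD (xi s)) (by simp) ?_ ?_
    · rw [eulerD_sub, eulerD_mul, eulerD_mul, hC, hE, mul_zero, add_zero, mul_sub, ← mul_assoc,
        ← mul_assoc, ← mul_assoc, hcomm, add_mul, add_comm (Φ * _ * _)]
    · have h0 : Φ.coeff 0 = f j := by rw [hΦ]; simp [kappa]
      rw [map_sub, PowerSeries.coeff_mul, PowerSeries.coeff_mul]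
      simp [expXiCoeff_zero_right, h0]
  have h1 := congrArg (PowerSeries.coeff b) (sub_eq_zero.1 hG)
  rw [PowerSeries.coeff_mul_C, PowerSeries.coeff_mul, coeff_expXi] at h1
  have h2 := congrArg (fun X : Module.End ℂ M => X v) h1
  simp only [Module.End.mul_apply, LinearMap.sum_apply, hΦ, coeff_expXi,
    LinearMap.smul_apply] at h2
  exact h2

end HalfVertex

/-- The times `-2 H_n / n` on the Fock space. -/
def fockTimes (i : ℕ) : Module.End ℂ Fock := (-2 / (2 * i + 1) : ℂ) • ham (2 * i + 1)

/-- The times `-2 ∂̃_n` on the polynomials. -/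
def polTimes (i : ℕ) : Module.End ℂ Pol :=
  (-2 / (2 * i + 1) : ℂ) • ((MvPolynomial.pderiv i : Derivation ℂ Pol Pol) : Module.End ℂ Pol)

theorem expH_polTimes (ω : Fock →ₗ[ℂ] ℂ) (b : ℕ) (v : Fock) :
    expXiCoeff polTimes b (expH ω v) = expH ω (expXiCoeff fockTimes b v) := by
  refine (expXiCoeff_map (L := expH ω) (s := fockTimes) (s' := polTimes) ?_ b v).symm
  intro i u
  rw [fockTimes, polTimes, LinearMap.smul_apply, LinearMap.smul_apply, map_smul,
    Derivation.coeFn_coe, pderiv_expH]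

theorem expXiCoeff_fockTimes_mem {N : ℤ} {v : Fock} (hv : v ∈ energyLE N) (b : ℕ) :
    expXiCoeff fockTimes b v ∈ energyLE (N - b) :=
  expXiCoeff_mem (F := energyLE) (fun i _ _ hu =>
    Submodule.smul_mem _ _ (ham_mem_energyLE (odd_time i) hu)) hv b

theorem expXiCoeff_fockTimes_phi (b : ℕ) (j : ℤ) (v : Fock) :
    expXiCoeff fockTimes b (phi j v) = ∑ x ∈ Finset.HasAntidiagonal.antidiagonal b,
      kappa x.1 • phi (j - x.1) (expXiCoeff fockTimes x.2 v) := by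
  have hs : fockTimes = fun i : ℕ => (-2 / (2 * i + 1) : ℂ) • ham (2 * i + 1) := rfl
  have hh : ∀ i k : ℕ, Commute (ham (2 * i + 1)) (ham (2 * k + 1)) := fun i k =>
    LinearMap.ext fun v => ham_comm (odd_time i) (odd_time k) (by omega) (by omega) v
  have h := expXiCoeff_apply_shift (M := Fock) (h := fun i => ham (2 * i + 1)) (f := phi) hs hh
    (fun i j v => ham_phi (odd_time i) j v) b j v
  exact h

/-- The relation `(1 + x y) e^{-2 ∑ H_n x^n / n} φ(y) = (1 - x y) φ(y) e^{-2 ∑ H_n x^n / n}`. -/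
theorem expXiCoeff_fockTimes_phi_succ (b : ℕ) (j : ℤ) (v : Fock) :
    expXiCoeff fockTimes (b + 1) (phi (j + 1) v) + expXiCoeff fockTimes b (phi j v) =
      phi (j + 1) (expXiCoeff fockTimes (b + 1) v) - phi j (expXiCoeff fockTimes b v) := by
  rw [expXiCoeff_fockTimes_phi, expXiCoeff_fockTimes_phi, Finset.Nat.sum_antidiagonal_succ,
    add_assoc, ← Finset.sum_add_distrib, Finset.sum_eq_single (0, b)]
  · simp only [kappa]
    norm_num
    module
  · rintro ⟨a, q⟩ _ hne
    have hx := Finset.HasAntidiagonal.mem_antidiagonal.1 ‹_›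
    have ha : a ≠ 0 := by
      rintro rfl
      simp at hx
      exact hne (by rw [hx])
    have h1 : j + 1 - ((a + 1 : ℕ) : ℤ) = j - a := by push_cast; ring
    simp only [h1, ← add_smul]
    have h2 : kappa (a + 1) + kappa a = 0 := by
      simp [kappa, ha, pow_succ]
    rw [h2, zero_smul]
  · intro h
    exact absurd (Finset.HasAntidiagonal.mem_antidiagonal.2 (by simp)) h

/-! ### The covector absorbing the zero mode -/

/-- The covector `⟨0| (1 + 2 c φ_0)`; for `c² = 1 / 2` it satisfies `w φ_0 = c w`. -/
def vacC (c : ℂ) : Fock →ₗ[ℂ] ℂ := vacL + (2 * c) • (vacL ∘ₗ phi 0)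

theorem vacC_apply (c : ℂ) (v : Fock) : vacC c v = vacL v + 2 * c * vacL (phi 0 v) := rfl

theorem vacC_phi_zero {c : ℂ} (hc : c * c = 1 / 2) (v : Fock) :
    vacC c (phi 0 v) = c * vacC c v := by
  rw [vacC_apply, vacC_apply, phi_zero_zero, map_smul, smul_eq_mul]
  linear_combination -(2 * vacL (phi 0 v)) * hc

theorem vacC_phi (c : ℂ) {n : ℤ} (hn : 0 < n) (v : Fock) : vacC c (phi n v) = 0 := by
  rw [vacC_apply, vacL_phi hn, phi_anticomm' (by omega), map_neg, vacL_phi hn]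
  simp

/-- A variant of `fock_ext_of_phi`, in which the zero mode occurs only next to the vacuum. -/
theorem fock_ext_of_phi_pos {M : Type*} [AddCommGroup M] [Module ℂ M] {f g : Fock →ₗ[ℂ] M}
    (h0 : f vac = g vac) (h1 : f (phi 0 vac) = g (phi 0 vac))
    (h : ∀ n : ℕ, ∀ v, f (phi (n + 1) v) = g (phi (n + 1) v)) : f = g := by
  refine fock_ext fun S => ?_
  induction S using Finset.induction_on_max with
  | empty => exact h0
  | insert a S hS _ =>
    rw [← phi_single_of_max hS]
    rcases a with _ | a
    · have : S = ∅ := Finset.eq_empty_of_forall_notMem fun x hx => Nat.not_lt_zero _ (hS x hx)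
      subst this
      exact h1
    · exact_mod_cast h a _

/-- The annihilation modes act on the covector `w` like the coefficients of
`c e^{-2 ∑ H_n x^n / n}`. This is where fermions turn into bosons. -/
theorem vacC_phi_neg {c : ℂ} (hc : c * c = 1 / 2) (b : ℕ) (v : Fock) :
    vacC c (phi (-b) v) = c * vacC c (expXiCoeff fockTimes b v) := by
  induction b generalizing v with
  | zero =>
    rw [expXiCoeff_zero_right, Nat.cast_zero, neg_zero, vacC_phi_zero hc, Module.End.one_apply]
  | succ b ih =>
    have hvac : ∀ i, fockTimes i vac = 0 := by
      intro i
      rw [fockTimes, LinearMap.smul_apply, ham_vac (by omega), smul_zero]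
    have hvac0 : ∀ i, fockTimes i (phi 0 vac) = 0 := by
      intro i
      rw [fockTimes, LinearMap.smul_apply, ham_phi (odd_time i), ham_vac (by omega), map_zero,
        phi_vac (by omega), add_zero, smul_zero]
    have hneg : (-((b + 1 : ℕ) : ℤ)) < 0 := by omega
    suffices h : vacC c ∘ₗ phi (-((b + 1 : ℕ) : ℤ)) =
        c • (vacC c ∘ₗ expXiCoeff fockTimes (b + 1)) from LinearMap.congr_fun h v
    refine fock_ext_of_phi_pos ?_ ?_ ?_
    · simp only [LinearMap.comp_apply, LinearMap.smul_apply]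
      rw [phi_vac hneg, expXiCoeff_apply_of_eq_zero hvac, if_neg (Nat.succ_ne_zero b)]
      simp
    · simp only [LinearMap.comp_apply, LinearMap.smul_apply]
      rw [phi_anticomm' (by omega : -((b + 1 : ℕ) : ℤ) + 0 ≠ 0), phi_vac hneg,
        expXiCoeff_apply_of_eq_zero hvac0,
        if_neg (Nat.succ_ne_zero b)]
      simp
    · intro j u
      simp only [LinearMap.comp_apply, LinearMap.smul_apply, smul_eq_mul]
      rw [eq_sub_of_add_eq (expXiCoeff_fockTimes_phi_succ b j u), map_sub, map_sub,
        vacC_phi c (by omega : (0 : ℤ) < (j : ℤ) + 1), mul_sub, mul_sub, ← ih, mul_zero]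
      -- Both sides reduce, by the anticommutation relations, to `(-1)^{b+1} δ_{bj} w u`; for
      -- `j = 0` the terms with `w φ_0 = c w` match by the induction hypothesis.
      have e1 := congrArg (vacC c) (phi_anticomm (-((b + 1 : ℕ) : ℤ)) (j + 1) u)
      have e2 := congrArg (vacC c) (phi_anticomm (-(b : ℤ)) j u)
      rw [map_add, vacC_phi c (by omega : (0 : ℤ) < (j : ℤ) + 1), map_smul, smul_eq_mul] at e1
      rw [map_add, map_smul, smul_eq_mul] at e2
      have e3 : vacC c (phi j (phi (-(b : ℤ)) u)) =
          c * vacC c (phi j (expXiCoeff fockTimes b u)) := by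
        rcases j with _ | j
        · rw [Nat.cast_zero, vacC_phi_zero hc, vacC_phi_zero hc, ih]
        · rw [vacC_phi c (by omega), vacC_phi c (by omega), mul_zero]
      have hcond : (-((b + 1 : ℕ) : ℤ) + (j + 1) = 0) ↔ (-(b : ℤ) + j = 0) := by omega
      have hsign : (-1 : ℂ) ^ (-((b + 1 : ℕ) : ℤ)) = -(-1) ^ (-(b : ℤ)) := by
        rw [neg_one_zpow_neg, neg_one_zpow_neg, Nat.cast_succ, neg_one_zpow_add]
        simp
      simp only [hcond, hsign] at e1
      split_ifs at e1 e2
      · linear_combination e1 + e2 - e3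
      · linear_combination e1 + e2 - e3

/-! ### Vertex operators and the boson–fermion correspondence -/

/-- The coefficient of `z ^ a` in `e^{ξ(t, z)}`, for an integer `a`. -/
def qPol (a : ℤ) : Pol :=
  if 0 ≤ a then expXiCoeff (fun i => (MvPolynomial.X i : Pol)) a.toNat else 0

theorem pderiv_qPol (i : ℕ) (a : ℤ) :
    MvPolynomial.pderiv i (qPol a) = qPol (a - (2 * i + 1)) := by
  rw [qPol, qPol]
  split_ifs with h1 h2 h2
  · rw [pderiv_expXiCoeff, if_pos (by omega)]
    congr 1; omega
  · rw [pderiv_expXiCoeff, if_neg (by omega)]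
  · omega
  · exact map_zero _

theorem constantCoeff_qPol (a : ℤ) :
    MvPolynomial.constantCoeff (qPol a) = if a = 0 then 1 else 0 := by
  rw [qPol]
  split_ifs with h1 h2 h2
  · rw [constantCoeff_expXiCoeff, if_pos (by omega)]
  · rw [constantCoeff_expXiCoeff, if_neg (by omega)]
  · omega
  · exact map_zero _

theorem expXiCoeff_polTimes_finite (p : Pol) : {b : ℕ | expXiCoeff polTimes b p ≠ 0}.Finite := by
  obtain ⟨v, rfl⟩ := vacExpH_surjective p
  obtain ⟨N, hN⟩ := exists_mem_energyLE v
  refine (Set.finite_Iic N).subset fun b hb => ?_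
  by_contra h
  rw [Set.mem_Iic] at h
  apply hb
  rw [vacExpH_eq, expH_polTimes,
    eq_zero_of_mem_energyLE (by omega) (expXiCoeff_fockTimes_mem hN b), map_zero]

theorem vertex_finite (m : ℤ) (p : Pol) :
    (fun b : ℕ => qPol (m + b) * expXiCoeff polTimes b p).HasFiniteSupport := by
  refine (expXiCoeff_polTimes_finite p).subset fun b hb h => hb ?_
  simp only [h, mul_zero]

theorem vertex_apply (m : ℤ) (p : Pol) :
    vertex m p = ∑ᶠ b : ℕ, qPol (m + b) * expXiCoeff polTimes b p := by
  have h1 : vertex m = opSum polBasis fun b : ℕ =>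
      LinearMap.mulLeft ℂ (qPol (m + b)) * expXiCoeff polTimes b := by
    refine congrArg (opSum polBasis) (funext fun b => ?_)
    rw [qPol]
    split_ifs
    · rfl
    · simp
  rw [h1]
  exact opSum_apply polBasis (A := fun b : ℕ =>
    LinearMap.mulLeft ℂ (qPol (m + b)) * expXiCoeff polTimes b) (vertex_finite m) p

/-- `[∂ / ∂t_n, Z_m] = Z_{m-n}`. -/
theorem pderiv_vertex (i : ℕ) (m : ℤ) (p : Pol) :
    MvPolynomial.pderiv i (vertex m p) =
      vertex m (MvPolynomial.pderiv i p) + vertex (m - (2 * i + 1)) p := by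
  rw [vertex_apply, vertex_apply, vertex_apply, ← Derivation.coeFn_coe,
    map_finsum (dT i) (vertex_finite m p), ← finsum_add_distrib (vertex_finite _ _)
    (vertex_finite _ _)]
  refine finsum_congr fun b => ?_
  have h1 : dT i (expXiCoeff polTimes b p) = expXiCoeff polTimes b (dT i p) := by
    refine expXiCoeff_map (fun k q => ?_) b p
    rw [polTimes, LinearMap.smul_apply, LinearMap.smul_apply, map_smul]
    exact congrArg _ (pderiv_comm i k q)
  rw [← h1, dT, Derivation.coeFn_coe, Derivation.leibniz, pderiv_qPol, smul_eq_mul, smul_eq_mul,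
    show m - (2 * (i : ℤ) + 1) + b = m + b - (2 * i + 1) by ring]
  ring

theorem constantCoeff_vertex_neg (b : ℕ) (p : Pol) :
    MvPolynomial.constantCoeff (vertex (-b) p) =
      MvPolynomial.constantCoeff (expXiCoeff polTimes b p) := by
  rw [vertex_apply, map_finsum MvPolynomial.constantCoeff (vertex_finite _ p),
    finsum_eq_single _ b]
  · rw [map_mul, constantCoeff_qPol, if_pos (by ring), one_mul]
  · intro k hk
    rw [map_mul, constantCoeff_qPol, if_neg (by omega), zero_mul]

theorem constantCoeff_vertex_pos {m : ℤ} (hm : 0 < m) (p : Pol) :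
    MvPolynomial.constantCoeff (vertex m p) = 0 := by
  rw [vertex_apply, map_finsum MvPolynomial.constantCoeff (vertex_finite _ p)]
  refine (finsum_congr fun k => ?_).trans finsum_zero
  rw [map_mul, constantCoeff_qPol, if_neg (by omega), zero_mul]

/-- The boson–fermion correspondence: `w e^{H(t)}` intertwines `φ_a` with `c Z_a`. -/
theorem expH_vacC_phi {c : ℂ} (hc : c * c = 1 / 2) (a : ℤ) (v : Fock) :
    expH (vacC c) (phi a v) = c • vertex a (expH (vacC c) v) := by
  rw [← sub_eq_zero]
  refine pol_eq_zero (S := Submodule.span ℂ (Set.range fun x : ℤ × Fock =>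
    expH (vacC c) (phi x.1 x.2) - c • vertex x.1 (expH (vacC c) x.2))) ?_ ?_
    (Submodule.subset_span ⟨(a, v), rfl⟩)
  · intro p hp
    induction hp using Submodule.span_induction with
    | zero => exact map_zero _
    | add p q _ _ hp hq => rw [map_add, hp, hq, add_zero]
    | smul r p _ hp => rw [Algebra.smul_def, map_mul, hp, mul_zero]
    | mem p hp =>
      obtain ⟨⟨a, v⟩, rfl⟩ := hp
      dsimp only
      rw [map_sub, constantCoeff_expH, Algebra.smul_def, map_mul]
      rcases le_or_gt a 0 with ha | ha
      · obtain ⟨b, rfl⟩ : ∃ b : ℕ, a = -b := ⟨a.natAbs, by omega⟩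
        rw [constantCoeff_vertex_neg, expH_polTimes, constantCoeff_expH, vacC_phi_neg hc]
        simp
      · rw [constantCoeff_vertex_pos ha, vacC_phi c ha, mul_zero, sub_zero]
  · intro i p hp
    induction hp using Submodule.span_induction with
    | zero => rw [map_zero]; exact zero_mem _
    | add p q _ _ hp hq => rw [map_add]; exact add_mem hp hq
    | smul r p _ hp => rw [Derivation.map_smul]; exact Submodule.smul_mem _ _ hp
    | mem p hp =>
      obtain ⟨⟨a, v⟩, rfl⟩ := hp
      have h1 := Submodule.subset_span (R := ℂ) (s := Set.range fun x : ℤ × Fock =>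
        expH (vacC c) (phi x.1 x.2) - c • vertex x.1 (expH (vacC c) x.2))
        ⟨(a, ham (2 * i + 1) v), rfl⟩
      have h2 := Submodule.subset_span (R := ℂ) (s := Set.range fun x : ℤ × Fock =>
        expH (vacC c) (phi x.1 x.2) - c • vertex x.1 (expH (vacC c) x.2))
        ⟨(a - (2 * i + 1), v), rfl⟩
      convert add_mem h1 h2 using 1
      dsimp only
      rw [map_sub, Derivation.map_smul, pderiv_expH, pderiv_vertex, pderiv_expH,
        ham_phi (odd_time i), map_add, smul_add]
      abel

theorem parity_phi_phi (a b : ℤ) (v : Fock) :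
    parity (phi a (phi b v)) = phi a (phi b (parity v)) := by
  rw [parity_phi, parity_phi, map_neg, neg_neg]

theorem vacL_parity (v : Fock) : vacL (parity v) = vacL v := by
  suffices h : vacL ∘ₗ parity = vacL from LinearMap.congr_fun h v
  refine fock_ext fun S => ?_
  rw [LinearMap.comp_apply, parity_single]
  by_cases hS : S = ∅
  · subst hS; simp
  · simp [vacL, Finsupp.single_eq_of_ne (Ne.symm hS)]

/-- The projection to the even part of the Fock space. -/
def evenProj : Module.End ℂ Fock := (1 / 2 : ℂ) • (1 + parity)

theorem evenProj_apply (v : Fock) : evenProj v = (1 / 2 : ℂ) • (v + parity v) := rfl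

/-- On the even part of the Fock space `w` and `⟨0|` agree, and `H(t)` preserves the parity. -/
theorem vacExpH_eq_comp (c : ℂ) : expH (vacC c) ∘ₗ evenProj = vacExpH := by
  refine eq_expH (fun v => ?_) fun i v => ?_
  · rw [LinearMap.comp_apply, constantCoeff_expH, vacC_apply]
    have h : vacL (phi 0 (parity v)) = -vacL (phi 0 v) := by
      rw [← vacL_parity (phi 0 v), parity_phi, map_neg, neg_neg]
    simp only [evenProj_apply, map_smul, map_add, h, vacL_parity, smul_eq_mul]
    ring
  · rw [LinearMap.comp_apply, LinearMap.comp_apply, pderiv_expH]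
    simp only [evenProj_apply, map_smul, map_add, parity_ham (odd_time i)]

/-- On matrix elements `⟨0| e^{H(t)} v` the bilinears `φ_a φ_b` act as `Z_a Z_b / 2`. -/
theorem vacExpH_phi_phi (a b : ℤ) (v : Fock) :
    vacExpH (phi a (phi b v)) = (1 / 2 : ℂ) • vertex a (vertex b (vacExpH v)) := by
  obtain ⟨c, hc⟩ := IsAlgClosed.exists_eq_mul_self (1 / 2 : ℂ)
  have h : evenProj (phi a (phi b v)) = phi a (phi b (evenProj v)) := by
    simp only [evenProj_apply, map_smul, map_add, parity_phi_phi]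
  rw [← vacExpH_eq_comp c, LinearMap.comp_apply, h, expH_vacC_phi hc.symm, expH_vacC_phi hc.symm,
    map_smul, smul_smul, ← hc, LinearMap.comp_apply]

/-! ### The flows `B_k` and the operators `Ω_{r,k}` -/

theorem opB_eq_quad (r : ℤ → ℂ) (k : ℕ) :
    opB r k = quad k fun n => (1 / 2 : ℂ) * (-1) ^ n * rProd r n k := rfl

/-- The value `[B_k, φ_j] = -r(j+1) ⋯ r(j+k) φ_{k+j}`: by the symmetry of `r` the two contractions
have equal coefficients. -/
theorem opB_phi_coef {r : ℤ → ℂ} (hr : ∀ n, r n = r (1 - n)) {k : ℕ} (hk : Odd k) (j : ℤ) :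
    (-1 : ℂ) ^ j * ((1 / 2 : ℂ) * (-1) ^ ((k : ℤ) + j) * rProd r (k + j) k -
      (1 / 2 : ℂ) * (-1) ^ (-j) * rProd r (-j) k) = -∏ i ∈ Finset.range k, r (j + 1 + i) := by
  have h1 : rProd r (k + j) k = ∏ i ∈ Finset.range k, r (j + 1 + i) := by
    rw [rProd, ← Finset.prod_range_reflect]
    refine Finset.prod_congr rfl fun i hi => ?_
    have := Finset.mem_range.1 hi
    congr 1; omega
  have h2 : rProd r (-j) k = ∏ i ∈ Finset.range k, r (j + 1 + i) := by
    refine Finset.prod_congr rfl fun i _ => ?_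
    rw [hr]
    congr 1; ring
  rw [h1, h2, neg_one_zpow_add, neg_one_zpow_neg, neg_one_zpow_odd ((Int.odd_coe_nat _).2 hk)]
  linear_combination -(∏ i ∈ Finset.range k, r (j + 1 + i)) * neg_one_zpow_mul_self j

/-- The flows `B_k` commute. -/
theorem opB_comm {r : ℤ → ℂ} (hr : ∀ n, r n = r (1 - n)) {k l : ℕ} (hk : Odd k) (hl : Odd l)
    (v : Fock) : opB r k (opB r l v) = opB r l (opB r k v) := by
  have hk0 : (0 : ℤ) < k := by exact_mod_cast hk.pos
  have hl0 : (0 : ℤ) < l := by exact_mod_cast hl.pos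
  have h := quad_comm hk0.ne' hl0.ne' (a := fun n => (1 / 2 : ℂ) * (-1) ^ n * rProd r n k)
    (b := fun n => (1 / 2 : ℂ) * (-1) ^ n * rProd r n l) (opB_phi_coef hr hk)
    (opB_phi_coef hr hl) ?_ v
  · rw [← opB_eq_quad, ← opB_eq_quad, map_sub, opB_eq_quad r k, vacL_quad hk0, opB_eq_quad r l,
      vacL_quad hl0, sub_zero, zero_smul, add_zero] at h
    exact h
  · intro j
    have key : ∀ a b : ℕ, (∏ i ∈ Finset.range a, r (j + 1 + i)) *
        (∏ i ∈ Finset.range b, r ((a : ℤ) + j + 1 + i)) =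
        ∏ i ∈ Finset.range (a + b), r (j + 1 + i) := by
      intro a b
      rw [Finset.prod_range_add]
      congr 1
      refine Finset.prod_congr rfl fun i _ => ?_
      congr 1; push_cast; ring
    rw [neg_mul_neg, neg_mul_neg, key, key, add_comm]

theorem vertex_vertex_vacExpH (a b : ℤ) (v : Fock) :
    vertex a (vertex b (vacExpH v)) = (2 : ℂ) • vacExpH (phi a (phi b v)) := by
  rw [vacExpH_phi_phi, smul_smul]; norm_num

theorem omegaTerm_vacExpH (r : ℤ → ℂ) {k : ℕ} (hk : Odd k) (m : ℤ) (v : Fock) :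
    omegaTerm r k m (vacExpH v) =
      vacExpH (-(((1 / 2 : ℂ) * (-1) ^ m * rProd r m k) • phi m (phi (k - m) v))) := by
  have hk0 : (k : ℤ) - m + m ≠ 0 := by have := hk.pos; omega
  rw [omegaTerm, LinearMap.smul_apply, Module.End.mul_apply, vertex_vertex_vacExpH,
    phi_anticomm' hk0, sub_eq_add_neg, neg_one_zpow_add, neg_one_zpow_neg,
    neg_one_zpow_odd ((Int.odd_coe_nat _).2 hk), map_neg, map_neg, map_smul, smul_neg, smul_neg,
    smul_smul, neg_inj]
  congr 1
  ring

theorem omegaTerm_finite (r : ℤ → ℂ) {k : ℕ} (hk : Odd k) : PointwiseFinite (omegaTerm r k) := by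
  intro p
  obtain ⟨v, rfl⟩ := vacExpH_surjective p
  refine (phi_phi_finite (k := k) (by exact_mod_cast hk.pos.ne') v).subset fun m hm h => hm ?_
  rw [omegaTerm_vacExpH r hk, h, smul_zero, neg_zero, map_zero]

/-- The boson–fermion correspondence sends `-B_k` to `Ω_{r,k}`. -/
theorem vacExpH_neg_opB (r : ℤ → ℂ) {k : ℕ} (hk : Odd k) (v : Fock) :
    vacExpH ((-opB r k) v) = omega r k (vacExpH v) := by
  have hk0 : (k : ℤ) ≠ 0 := by exact_mod_cast hk.pos.ne'
  rw [omega, opSum_apply polBasis (omegaTerm_finite r hk),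
    finsum_congr fun m => omegaTerm_vacExpH r hk m v, LinearMap.neg_apply, opB_eq_quad,
    quad_apply hk0, map_neg, map_finsum vacExpH (quad_finite' hk0 _ v), ← finsum_neg_distrib]
  exact finsum_congr fun m => (map_neg _ _).symm

theorem odd_two_mul_add_one (i : ℕ) : Odd (2 * i + 1) := ⟨i, rfl⟩

theorem neg_opB_commute {r : ℤ → ℂ} (hr : ∀ n, r n = r (1 - n)) (i k : ℕ) :
    Commute (-opB r (2 * i + 1)) (-opB r (2 * k + 1)) := by
  refine LinearMap.ext fun v => ?_
  simp only [Module.End.mul_apply, LinearMap.neg_apply, map_neg, neg_neg]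
  exact opB_comm hr (odd_two_mul_add_one i) (odd_two_mul_add_one k) v

theorem omega_commute {r : ℤ → ℂ} (hr : ∀ n, r n = r (1 - n)) (i k : ℕ) :
    Commute (omega r (2 * i + 1)) (omega r (2 * k + 1)) := by
  refine LinearMap.ext fun p => ?_
  obtain ⟨v, rfl⟩ := vacExpH_surjective p
  have h : ∀ i k : ℕ, omega r (2 * i + 1) (omega r (2 * k + 1) (vacExpH v)) =
      vacExpH ((-opB r (2 * i + 1) * -opB r (2 * k + 1)) v) := by
    intro i k
    rw [Module.End.mul_apply, vacExpH_neg_opB r (odd_two_mul_add_one i),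
      vacExpH_neg_opB r (odd_two_mul_add_one k)]
  rw [Module.End.mul_apply, Module.End.mul_apply, h, h, (neg_opB_commute hr i k).eq]

/-- The tau-function solves `∂τ / ∂t*_k = Ω_{r,k} τ`. -/
theorem coeffD_tau {r : ℤ → ℂ} (hr : ∀ n, r n = r (1 - n)) (i : ℕ) (α : ℕ →₀ ℕ) :
    coeffD i (tau r) α = omega r (2 * i + 1) (tau r α) := by
  have h := congrArg vacExpH (coeffD_timeExp_const (neg_opB_commute hr) i vac α)
  rw [vacExpH_neg_opB r (odd_two_mul_add_one i)] at h
  exact (map_smul vacExpH _ _).symm.trans h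

theorem vacExpH_pi_single (α : ℕ →₀ ℕ) :
    vacExpH (Pi.single (M := fun _ : ℕ →₀ ℕ => Fock) 0 vac α) = (1 : MvPowerSeries ℕ Pol) α := by
  have h : (1 : MvPowerSeries ℕ Pol) α = if α = 0 then 1 else 0 :=
    MvPowerSeries.coeff_one (R := Pol) α
  rw [h]
  by_cases hα : α = 0
  · subst hα
    rw [Pi.single_eq_same, vacExpH_vac, if_pos rfl]
  · rw [Pi.single_eq_of_ne hα, map_zero, if_neg hα]

/-- If `f` intertwines the flows `-B_k` with operators `A_k` on the polynomials, then the
tau-function is `e^{∑ t*_k A_k} 1`. -/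
theorem tau_eq_timeExp {r : ℤ → ℂ} {A : ℕ → Module.End ℂ Pol}
    (h : ∀ i v, vacExpH ((-opB r (2 * i + 1)) v) = A i (vacExpH v)) :
    tau r = timeExp A (1 : MvPowerSeries ℕ Pol) := by
  funext α
  have h1 := timeExp_map (L := vacExpH) (A := fun i : ℕ => -opB r (2 * i + 1)) h
    (Pi.single 0 vac) α
  have h2 : (fun α => vacExpH (Pi.single (M := fun _ : ℕ →₀ ℕ => Fock) 0 vac α)) =
    (1 : MvPowerSeries ℕ Pol) := funext vacExpH_pi_single
  rw [h2] at h1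
  exact h1

/-! ### The operators `Z_{nn}` -/

/-- The total weight `∑_{n ∈ S} γ_n` of an index set. -/
def weight (γ : ℤ → ℂ) (S : Finset ℕ) : ℂ := ∑ n ∈ S, γ n

theorem phi_phi_neg_single {n : ℕ} (hn : 0 < n) (S : Finset ℕ) :
    phi n (phi (-n) (Finsupp.single S 1)) =
      (if n ∈ S then (-1 : ℂ) ^ n else 0) • Finsupp.single S 1 := by
  have hn' : (0 : ℤ) < n := by omega
  have hmem : n ∈ S ∆ {n} ↔ ¬ n ∈ S := by simp [Finset.mem_symmDiff]
  rw [phi_single, phi_single, Int.natAbs_neg, Int.natAbs_natCast, symmDiff_assoc, symmDiff_self,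
    symmDiff_bot, moveSign_symmDiff_of_le le_rfl, phiCoef_congr hmem, Finsupp.smul_single]
  congr 1
  have hs := moveSign_mul_self S n
  by_cases h : n ∈ S
  · simp only [phiCoef, h]
    simp [hn.ne', hn'.not_gt]
    linear_combination (-1 : ℂ) ^ n * hs
  · simp [phiCoef, h, hn.ne']

theorem vertexNN_vacExpH (n : ℤ) (v : Fock) :
    vertexNN n (vacExpH v) = vacExpH (((-1 : ℂ) ^ (n + 1) / 2) •
      (phi n (phi (-n) v) - vacL (phi n (phi (-n) vac)) • v)) := by
  rw [vertexNN, ← vacExpH_vac]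
  simp only [LinearMap.smul_apply, LinearMap.sub_apply, Module.End.mul_apply, Module.End.one_apply,
    vertex_vertex_vacExpH, map_smul, map_sub]
  have h : MvPolynomial.constantCoeff ((2 : ℂ) • vacExpH (phi n (phi (-n) vac))) =
      2 * vacL (phi n (phi (-n) vac)) := by
    rw [Algebra.smul_def, map_mul, vacExpH_eq, constantCoeff_expH]
    simp
  rw [h, mul_smul, ← smul_sub, smul_smul]
  congr 1
  ring

/-- The normally ordered products `φ_n φ_{-n}` are diagonal. -/
theorem normal_order_single (n : ℤ) (hn : n ≠ 0) (S : Finset ℕ) :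
    phi n (phi (-n) (Finsupp.single S 1)) -
      vacL (phi n (phi (-n) vac)) • (Finsupp.single S 1 : Fock) =
      ((if 0 < n then 1 else -1) * if n.natAbs ∈ S then (-1 : ℂ) ^ n else 0) •
        (Finsupp.single S 1 : Fock) := by
  rw [vacL_phi_phi_vac]
  rcases lt_or_gt_of_ne hn with h | h
  · obtain ⟨m, rfl⟩ : ∃ m : ℕ, n = -m := ⟨n.natAbs, by omega⟩
    have h1 := phi_anticomm (-m) m (Finsupp.single S 1)
    rw [if_pos (by ring), phi_phi_neg_single (by omega)] at h1
    rw [if_neg h.not_gt, if_neg hn, if_neg h.not_gt, neg_neg, eq_sub_of_add_eq h1, Int.natAbs_neg,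
      Int.natAbs_natCast, neg_one_zpow_neg, zpow_natCast]
    module
  · obtain ⟨m, rfl⟩ : ∃ m : ℕ, n = m := ⟨n.natAbs, by omega⟩
    rw [if_pos h, if_pos h, phi_phi_neg_single (by omega), Int.natAbs_natCast, zpow_natCast]
    module

/-- The share of the index `n ∈ ℤ` in the eigenvalue `-∑_{m ∈ S} γ_m`: the indices `m` and `-m`
contribute equally. -/
def nnCoef (γ : ℤ → ℂ) (n : ℤ) (S : Finset ℕ) : ℂ :=
  if n.natAbs ∈ S then -γ n.natAbs / 2 else 0

theorem smul_vertexNN_vacExpH {γ : ℤ → ℂ} (hγ : ∀ n, γ (-n) = -γ n) (n : ℤ) (v : Fock) :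
    (γ n • vertexNN n) (vacExpH v) = vacExpH (diagOp (nnCoef γ n) v) := by
  have h0 : γ 0 = 0 := by have := hγ 0; rw [neg_zero] at this; linear_combination this / 2
  suffices h : (γ n • vertexNN n) ∘ₗ vacExpH = vacExpH ∘ₗ diagOp (nnCoef γ n) from
    LinearMap.congr_fun h v
  refine fock_ext fun S => ?_
  rw [LinearMap.comp_apply, LinearMap.comp_apply, diagOp_single, one_mul, LinearMap.smul_apply,
    vertexNN_vacExpH, ← map_smul]
  congr 1
  by_cases hn : n = 0
  · subst hn
    simp [h0, nnCoef]
  · have hs := neg_one_zpow_mul_self n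
    rw [normal_order_single n hn, smul_smul, smul_smul, Finsupp.smul_single, smul_eq_mul, mul_one,
      neg_one_zpow_add, zpow_one, nnCoef]
    congr 1
    by_cases hS : n.natAbs ∈ S
    · rw [if_pos hS, if_pos hS]
      rcases lt_or_gt_of_ne hn with h | h
      · have hγn : γ n = -γ n.natAbs := by rw [← hγ]; congr 1; omega
        rw [if_neg h.not_gt, hγn]
        linear_combination (-γ n.natAbs / 2) * hs
      · have hγn : γ n = γ n.natAbs := by congr 1; omega
        rw [if_pos h, ← hγn]
        linear_combination (-γ n / 2) * hs
    · rw [if_neg hS, if_neg hS]; ring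

theorem vertexNN_finite {γ : ℤ → ℂ} (hγ : ∀ n, γ (-n) = -γ n) :
    PointwiseFinite fun n : ℤ => γ n • vertexNN n := by
  intro p
  obtain ⟨v, rfl⟩ := vacExpH_surjective p
  induction v using Finsupp.induction_linear with
  | zero => simp
  | add u v hu hv =>
    refine (hu.union hv).subset fun n hn => ?_
    by_contra h
    simp only [Set.mem_union, Set.mem_ofPred_eq, not_or, not_not] at h
    exact hn (by rw [map_add, map_add, h.1, h.2, add_zero])
  | single S a =>
    refine Set.Finite.subset ((S.image fun m : ℕ => (m : ℤ)) ∪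
      (S.image fun m : ℕ => -(m : ℤ))).finite_toSet fun n hn => ?_
    rw [Set.mem_ofPred_eq, smul_vertexNN_vacExpH hγ, diagOp_single, nnCoef] at hn
    have hS : n.natAbs ∈ S := by
      by_contra h
      exact hn (by rw [if_neg h]; simp)
    simp only [Finset.coe_union, Finset.coe_image, Set.mem_union, Set.mem_image, Finset.mem_coe]
    rcases le_or_gt 0 n with h | h
    · exact Or.inl ⟨_, hS, by omega⟩
    · exact Or.inr ⟨_, hS, by omega⟩

theorem finsum_nnCoef {γ : ℤ → ℂ} (h0 : γ 0 = 0) (S : Finset ℕ) :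
    (fun n => nnCoef γ n S).HasFiniteSupport ∧ ∑ᶠ n : ℤ, nnCoef γ n S = -weight γ S := by
  induction S using Finset.induction_on with
  | empty =>
    have h : (fun n => nnCoef γ n ∅) = fun _ => 0 := by funext n; simp [nnCoef]
    refine ⟨?_, ?_⟩
    · rw [h]; simp [Function.HasFiniteSupport]
    · rw [h, finsum_zero]; simp [weight]
  | insert m S hm ih =>
    have h : ∀ n, nnCoef γ n (insert m S) = nnCoef γ n S +
        ((if n = m then -γ m / 2 else 0) + if n = -m then -γ m / 2 else 0) := by
      intro n
      by_cases hn : n.natAbs = m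
      · have hS : n.natAbs ∉ S := hn ▸ hm
        rw [nnCoef, nnCoef, if_neg hS, if_pos (by simp [hn]), hn]
        rcases Nat.eq_zero_or_pos m with rfl | hm0
        · simp [h0]
        · rcases Int.natAbs_eq n with h | h
          · rw [if_pos (by omega), if_neg (by omega)]; ring
          · rw [if_neg (by omega), if_pos (by omega)]; ring
      · have : n.natAbs ∈ insert m S ↔ n.natAbs ∈ S := by simp [hn]
        rw [nnCoef, nnCoef, if_neg (by omega : ¬ n = m), if_neg (by omega : ¬ n = -m)]
        simp only [this, add_zero]
    have f1 : (fun n : ℤ => if n = m then -γ m / 2 else 0).HasFiniteSupport :=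
      (Set.finite_singleton (m : ℤ)).subset fun n hn => by
        by_contra h; exact hn (if_neg h)
    have f2 : (fun n : ℤ => if n = -m then -γ m / 2 else 0).HasFiniteSupport :=
      (Set.finite_singleton (-(m : ℤ))).subset fun n hn => by
        by_contra h; exact hn (if_neg h)
    have f3 : (fun n : ℤ => (if n = m then -γ m / 2 else 0) +
        if n = -m then -γ m / 2 else 0).HasFiniteSupport := f1.add f2
    refine ⟨?_, ?_⟩
    · rw [funext h]
      exact ih.1.add f3
    · rw [finsum_congr h, finsum_add_distrib ih.1 f3, finsum_add_distrib f1 f2, ih.2,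
        finsum_eq_single (fun n : ℤ => if n = m then _ else _) (m : ℤ) fun n hn => if_neg hn,
        finsum_eq_single (fun n : ℤ => if n = -m then _ else _) (-(m : ℤ)) fun n hn => if_neg hn,
        if_pos rfl, if_pos rfl, weight, weight, Finset.sum_insert hm]
      ring

/-- The operator `∑ γ_n Z_{nn}` is diagonal in the image of the standard basis of the Fock space. -/
theorem sumNN_vacExpH {γ : ℤ → ℂ} (hγ : ∀ n, γ (-n) = -γ n) (v : Fock) :
    sumNN γ (vacExpH v) = vacExpH (diagOp (fun S => -weight γ S) v) := by
  have h0 : γ 0 = 0 := by have := hγ 0; rw [neg_zero] at this; linear_combination this / 2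
  suffices h : sumNN γ ∘ₗ vacExpH = vacExpH ∘ₗ diagOp (fun S => -weight γ S) from
    LinearMap.congr_fun h v
  refine fock_ext fun S => ?_
  have hsingle : ∀ x : ℂ, (Finsupp.single S x : Fock) = x • Finsupp.single S 1 := by simp
  rw [LinearMap.comp_apply, LinearMap.comp_apply, diagOp_single, one_mul, sumNN,
    opSum_apply polBasis (vertexNN_finite hγ),
    finsum_congr fun n => smul_vertexNN_vacExpH hγ n (Finsupp.single S 1)]
  have h1 : ∀ n, vacExpH (diagOp (nnCoef γ n) (Finsupp.single S 1)) =
      nnCoef γ n S • vacExpH (Finsupp.single S 1) := by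
    intro n
    rw [diagOp_single, one_mul, hsingle, map_smul]
  rw [finsum_congr h1, ← finsum_smul, (finsum_nnCoef h0 S).2, hsingle (-weight γ S), map_smul]

theorem hasSum_exp_sumNN {γ : ℤ → ℂ} (hγ : ∀ n, γ (-n) = -γ n) (d : ℕ →₀ ℕ) (v : Fock) :
    HasSum (fun k : ℕ => MvPolynomial.coeff d (((Nat.factorial k : ℂ)⁻¹) •
        (sumNN γ ^ k) (vacExpH v)))
      (MvPolynomial.coeff d (vacExpH (diagOp (fun S => Complex.exp (-weight γ S)) v))) := by
  induction v using Finsupp.induction_linear with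
  | zero => simp only [map_zero, smul_zero, MvPolynomial.coeff_zero]; exact hasSum_zero
  | add u v hu hv =>
    simp only [map_add, smul_add, MvPolynomial.coeff_add]
    exact hu.add hv
  | single S a =>
    have h1 : ∀ k, (sumNN γ ^ k) (vacExpH (Finsupp.single S a)) =
        (-weight γ S) ^ k • vacExpH (Finsupp.single S a) := by
      intro k
      induction k with
      | zero => simp
      | succ k ih =>
        rw [pow_succ', Module.End.mul_apply, ih, map_smul, sumNN_vacExpH hγ, diagOp_single,
          pow_succ, mul_smul, ← map_smul _ (-weight γ S), Finsupp.smul_single, smul_eq_mul,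
          mul_comm a]
    have h2 : diagOp (fun S => Complex.exp (-weight γ S)) (Finsupp.single S a) =
        Complex.exp (-weight γ S) • Finsupp.single S a := by
      rw [diagOp_single, Finsupp.smul_single, smul_eq_mul, mul_comm]
    simp only [h1, h2, map_smul, MvPolynomial.coeff_smul, smul_eq_mul]
    have h3 := (NormedSpace.expSeries_div_hasSum_exp (𝔸 := ℂ) (-weight γ S)).mul_right
      (MvPolynomial.coeff d (vacExpH (Finsupp.single S a)))
    rw [← Complex.exp_eq_exp_ℂ] at h3
    refine h3.congr_fun fun k => ?_
    ring

/-! ### Conjugation of the flows by diagonal operators -/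

/-- The exponential of the diagonal operator rescales the fermions; annihilation and creation
modes obey one formula because `γ` is odd. -/
theorem diagOp_exp_phi {γ : ℤ → ℂ} (hγ : ∀ n, γ (-n) = -γ n) (n : ℤ) (v : Fock) :
    diagOp (fun S => Complex.exp (-weight γ S)) (phi n v) =
      Complex.exp (-γ n) • phi n (diagOp (fun S => Complex.exp (-weight γ S)) v) := by
  suffices h : diagOp (fun S => Complex.exp (-weight γ S)) * phi n =
      Complex.exp (-γ n) • (phi n * diagOp (fun S => Complex.exp (-weight γ S))) from
    congrArg (fun X : Module.End ℂ Fock => X v) h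
  refine fock_ext fun S => ?_
  simp only [Module.End.mul_apply, LinearMap.smul_apply, diagOp_single, phi_single,
    Finsupp.smul_single, smul_eq_mul, one_mul]
  congr 1
  by_cases hn : n.natAbs ∈ S
  · rcases lt_or_ge 0 n with h | h
    · simp [phiCoef, hn, h]
    · have hw : weight γ (S ∆ {n.natAbs}) = weight γ S + γ n := by
        have h1 := Finset.sum_erase_add S (fun m : ℕ => γ m) hn
        have h2 : γ (n.natAbs : ℤ) = -γ n := by rw [← hγ]; congr 1; omega
        rw [symmDiff_singleton_of_mem hn, weight, weight]
        linear_combination h1 - h2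
      rw [hw, neg_add, Complex.exp_add]
      ring
  · rcases lt_or_ge n 0 with h | h
    · simp [phiCoef, hn, h.not_ge]
    · have hw : weight γ (S ∆ {n.natAbs}) = γ n + weight γ S := by
        rw [symmDiff_singleton_of_notMem hn, weight, weight, Finset.sum_insert hn]
        congr 2; omega
      rw [hw, neg_add, Complex.exp_add]
      ring

/-- For `r(n) = e^{T_{n-1} - T_n}` the product `r(n) ⋯ r(n-k+1)` telescopes. -/
theorem rProd_rOfT (T : ℤ → ℂ) (n : ℤ) (k : ℕ) :
    rProd (rOfT T) n k = Complex.exp (T (n - k) - T n) := by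
  induction k with
  | zero => simp [rProd]
  | succ k ih =>
    rw [rProd, Finset.prod_range_succ, ← rProd, ih, rOfT, ← Complex.exp_add]
    congr 1
    rw [show n - (k : ℤ) - 1 = n - ((k + 1 : ℕ) : ℤ) by push_cast; ring]
    ring

theorem diagOp_exp_opB {γ : ℤ → ℂ} (hγ : ∀ n, γ (-n) = -γ n) (T : ℤ → ℂ) {k : ℕ} (hk : k ≠ 0)
    (v : Fock) : diagOp (fun S => Complex.exp (-weight γ S)) (opB (rOfT T) k v) =
      opB (rOfT (T + γ)) k (diagOp (fun S => Complex.exp (-weight γ S)) v) := by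
  have hk0 : (k : ℤ) ≠ 0 := by exact_mod_cast hk
  rw [opB_eq_quad, opB_eq_quad, quad_apply hk0, quad_apply hk0,
    map_finsum (diagOp _) (quad_finite' hk0 _ v)]
  refine finsum_congr fun n => ?_
  rw [map_smul, diagOp_exp_phi hγ, diagOp_exp_phi hγ, map_smul, smul_smul, smul_smul, rProd_rOfT,
    rProd_rOfT, Pi.add_apply, Pi.add_apply]
  congr 1
  rw [mul_assoc (1 / 2 * (-1 : ℂ) ^ n), ← Complex.exp_add, mul_assoc (1 / 2 * (-1 : ℂ) ^ n),
    ← Complex.exp_add]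
  congr 2
  rw [show (k : ℤ) - n = -(n - k) by ring, hγ]
  ring

theorem diagOp_exp_expBVac {γ : ℤ → ℂ} (hγ : ∀ n, γ (-n) = -γ n) (T : ℤ → ℂ) (α : ℕ →₀ ℕ) :
    diagOp (fun S => Complex.exp (-weight γ S)) (expBVac (rOfT T) α) =
      expBVac (rOfT (T + γ)) α := by
  rw [expBVac, expBVac, timeExp_map (B := fun i : ℕ => -opB (rOfT (T + γ)) (2 * i + 1))]
  · congr 1
    funext β
    by_cases hβ : β = 0
    · subst hβ
      rw [Pi.single_eq_same, vac, diagOp_single]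
      simp [weight]
    · rw [Pi.single_eq_of_ne hβ, map_zero]
  · intro i v
    rw [LinearMap.neg_apply, LinearMap.neg_apply, map_neg, diagOp_exp_opB hγ T (by omega)]

theorem isExpApply_tauT {γ : ℤ → ℂ} (hγ : ∀ n, γ (-n) = -γ n) (T : ℤ → ℂ) :
    IsExpApply (sumNN γ) (tauT T) (tauT (T + γ)) := by
  intro α d
  have h := hasSum_exp_sumNN hγ d (expBVac (rOfT T) α)
  rw [diagOp_exp_expBVac hγ] at h
  exact h

/-- At `T = 0` the flows `-B_k` are the Hamiltonians `H_{-k}`. -/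
theorem neg_opB_rOfT_zero (k : ℕ) (hk : k ≠ 0) (v : Fock) :
    (-opB (rOfT 0) k) v = ham (-k) v := by
  have hk0 : (k : ℤ) ≠ 0 := by exact_mod_cast hk
  rw [LinearMap.neg_apply, opB_eq_quad, ham_eq_quad, neg_neg, quad_apply hk0, quad_apply hk0,
    ← finsum_neg_distrib]
  refine finsum_congr fun n => ?_
  rw [← neg_smul, rProd_rOfT, neg_one_zpow_add]
  simp

theorem tauT_zero : tauT 0 = tauVac := by
  refine tau_eq_timeExp fun i v => ?_
  rw [neg_opB_rOfT_zero _ (by omega)]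
  have h := vacExpH_ham_neg i v
  rw [LinearMap.mulLeft_apply, smul_mul_assoc, ← h]
  push_cast
  rfl

end

end BKP


theorem proposition8 :
    -- first shift formula and its special case, with the operators `Ω` well defined
    (∀ r : ℤ → ℂ, (∀ n : ℤ, r n = r (1 - n)) →
      (∀ k : ℕ, Odd k → BKP.PointwiseFinite (BKP.omegaTerm r k)) ∧
      BKP.expOmegaGamma r (BKP.inTimes (BKP.tau r)) = BKP.shiftTimes (BKP.tau r) ∧
      BKP.expOmega r 1 = BKP.tau r) ∧
    -- second shift formula and its special case, with the operators `∑ γ_n Z_nn` well defined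
    (∀ γ : ℤ → ℂ, (∀ n : ℤ, γ (-n) = -γ n) →
      BKP.PointwiseFinite (fun n : ℤ => γ n • BKP.vertexNN n) ∧
      (∀ T : ℤ → ℂ, (∀ n : ℤ, T (-n) = -T n) →
        BKP.IsExpApply (BKP.sumNN γ) (BKP.tauT T) (BKP.tauT (T + γ))) ∧
      BKP.IsExpApply (BKP.sumNN γ) BKP.tauVac (BKP.tauT γ)) := by
  refine ⟨fun r hr => ⟨fun k hk => BKP.omegaTerm_finite r hk, ?_, ?_⟩,
    fun γ hγ => ⟨BKP.vertexNN_finite hγ, fun T _ => BKP.isExpApply_tauT hγ T, ?_⟩⟩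
  · exact BKP.timeExp_inTimes (BKP.omega_commute hr) (BKP.coeffD_tau hr)
  · exact (BKP.tau_eq_timeExp fun i v =>
      BKP.vacExpH_neg_opB r (BKP.odd_two_mul_add_one i) v).symm
  · have h := BKP.isExpApply_tauT hγ 0
    rwa [zero_add, BKP.tauT_zero] at h
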